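/- **Setting.** For $\lambda\in\mathbb C$ let $\xi_\lambda$ be the solution on $(-\pi/2,\pi/2)$ of $\xi''(v)+\frac{\lambda}{\cos^2 v}\,\xi(v)=0$, $\xi(0)=1$, $\xi'(0)=0$. The Huber transform of $f$ is $$d(f,t)=\int_0^{\pi/2} f\Big(\frac1{\cos^2 v}\Big)\frac{\xi_\lambda(v)}{\cos^2 v}\,dv,\qquad \lambda=\tfrac14+t^2 .$$ For $X\ge 2$ put $U=\sqrt{X^2-1}$, let $U<V<2U$, $Y=V-U$, and let $f^+$ be the function on $[1,\infty)$ with $f^+(x^2+1)=1$ for $0\le x\le U$, $f^+(x^2+1)=\frac{V-x}{V-U}$ for $U\le x\le V$, $f^+(x^2+1)=0$ for $x\ge V$. Put $$B(s)=2^{s-2}\big(e^{i\frac\pi2(s-1)}+e^{-i\frac\pi2(s-1)}\big)\frac{\Gamma(\frac{s+1}2)\Gamma(1-\frac s2)\Gamma(s-\frac12)}{\pi\,\Gamma(s+2)},\qquad D(s)=\big(e^{-i\frac\pi2 s}+e^{i\frac\pi2 s}\big)\frac{\Gamma(\frac{s+1}2)\Gamma(1-\frac s2)\Gamma(\frac12-s)}{\pi\,\Gamma(3-s)\,2^{s+1}}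 .$$ All implied constants below are absolute, i.e. uniform in $t$ (or $s$), $X\ge2$ and $0<Y<U$. **Proposition.** a) Let $s=\frac12+it$ with $t\in\mathbb R\setminus\{0\}$ or $s\in(\frac12,1]$. Then $$d(f^+,t)=B(s)(s+1)X^{s}+D(s)(2-s)X^{1-s}+O\Big(\big(|B(s)X^{s-1}|+|D(s)X^{-s}|\big)(1+|t|^2)(Y+X^{-1})\Big).$$ b) For real $t\ne0$, $$d(f^+,t)=a\,X^{1/2+it}+b\,X^{1/2-it},$$ where the coefficients $a=a(t,X,Y)$, $b=b(t,X,Y)$ satisfy $a,b=O\big(t^{-2}\min\{|t|,X/Y\}\big)$ and are, up to lower order terms, functions of $t$ and $Y/X$ only: there are functions $\alpha(t,y)$, $\beta(t,y)$ with $\alpha(t,Y/X),\beta(t,Y/X)=O\big(t^{-2}\min\{|t|,X/Y\}\big)$ and $a=\alpha(t,Y/X)+O\big((1+|t|^{-1})X^{-2}\big)$, $b=\beta(t,Y/X)+O\big((1+|t|^{-1})X^{-2}\big)$. Hence $d(f^+,t)=O\big(t^{-2}\min\{|t|,X/Y\}X^{1/2}\big)$. c) For $s=\frac12+it\in(\frac12,1]$,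 $$d(f^+,t)=B(s)(s+1)X^{s}+D(s)(2-s)X^{1-s}+O\Big(|\Gamma(s-\tfrac12)|\,Y+|\Gamma(\tfrac12-s)|\,X^{1/2}\Big).$$ d) $d(f^+,0)=O(X^{1/2}\log X)$. -/

import Mathlib

open Set

noncomputable section

namespace Huber

/-! ### The special function `ξ_λ` -/

/-- `ξ` solves `ξ''(v) + λ / cos² v · ξ(v) = 0` on `(-π/2, π/2)` with `ξ(0) = 1`, `ξ'(0) = 0`
(the function `η` is the derivative of `ξ`). -/
def IsXi (lam : ℂ) (ξ : ℝ → ℂ) : Prop :=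
  ∃ η : ℝ → ℂ,
    (∀ v ∈ Ioo (-(Real.pi / 2)) (Real.pi / 2),
      HasDerivAt ξ (η v) v ∧ HasDerivAt η (-(lam / (Real.cos v : ℂ) ^ 2 * ξ v)) v) ∧
    ξ 0 = 1 ∧ η 0 = 0

/-- Successive approximations for `ξ_λ` in the variable `x = tan v`. -/
def picardTerm (lam : ℂ) : ℕ → ℝ → ℂ
  | 0 => fun _ => 1
  | n + 1 => fun x => ∫ y in (0 : ℝ)..x, -lam / (1 + (y : ℂ) ^ 2) *
      ∫ z in (0 : ℝ)..y, picardTerm lam n z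

/-- The primitive of `picardTerm` that vanishes at `0`. -/
def picardPrim (lam : ℂ) (n : ℕ) (x : ℝ) : ℂ := ∫ z in (0 : ℝ)..x, picardTerm lam n z

theorem one_add_sq_ne_zero (y : ℝ) : (1 : ℂ) + (y : ℂ) ^ 2 ≠ 0 := by
  have h : (1 + y ^ 2 : ℝ) ≠ 0 := by positivity
  exact_mod_cast h

theorem continuous_coef (lam : ℂ) : Continuous fun y : ℝ => -lam / (1 + (y : ℂ) ^ 2) := by
  refine Continuous.div continuous_const (by fun_prop) one_add_sq_ne_zero

theorem continuous_picardTerm (lam : ℂ) (n : ℕ) : Continuous (picardTerm lam n) := by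
  induction n with
  | zero => exact continuous_const
  | succ n ih =>
    have h1 : Continuous fun y : ℝ => ∫ z in (0 : ℝ)..y, picardTerm lam n z :=
      intervalIntegral.continuous_primitive (fun a b => ih.intervalIntegrable a b) 0
    exact intervalIntegral.continuous_primitive
      (fun a b => ((continuous_coef lam).mul h1).intervalIntegrable a b) 0

theorem hasDerivAt_picardPrim (lam : ℂ) (n : ℕ) (x : ℝ) :
    HasDerivAt (picardPrim lam n) (picardTerm lam n x) x :=
  (continuous_picardTerm lam n).integral_hasStrictDerivAt 0 x |>.hasDerivAt

theorem hasDerivAt_picardTerm_succ (lam : ℂ) (n : ℕ) (x : ℝ) :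
    HasDerivAt (picardTerm lam (n + 1)) (-lam / (1 + (x : ℂ) ^ 2) * picardPrim lam n x) x := by
  have h1 : Continuous (picardPrim lam n) :=
    intervalIntegral.continuous_primitive
      (fun a b => (continuous_picardTerm lam n).intervalIntegrable a b) 0
  exact (((continuous_coef lam).mul h1).integral_hasStrictDerivAt 0 x).hasDerivAt

theorem norm_integral_le_of_pow {f : ℝ → ℂ} {K R : ℝ} {n : ℕ}
    (h : ∀ y, |y| ≤ R → ‖f y‖ ≤ K * |y| ^ n) {x : ℝ} (hx : |x| ≤ R) :
    ‖∫ y in (0 : ℝ)..x, f y‖ ≤ K * (|x| ^ (n + 1) / (n + 1)) := by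
  have h1 := intervalIntegral.norm_integral_le_abs_of_norm_le (a := 0) (b := x) (f := f)
    (g := fun y => K * |y| ^ n) (μ := MeasureTheory.volume)
    ((MeasureTheory.ae_restrict_iff' measurableSet_uIoc).2 (Filter.Eventually.of_forall ?_)) ?_
  · refine h1.trans ?_
    have h2 : |∫ y in (0 : ℝ)..x, K * |y| ^ n| = |K * (|x| ^ (n + 1) / (n + 1))| := by
      rw [intervalIntegral.integral_const_mul, abs_mul, abs_mul]
      congr 1
      have h3 := integral_pow_abs_sub_uIoc (a := 0) (b := x) n
      simp only [sub_zero] at h3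
      rw [intervalIntegral.abs_intervalIntegral_eq, h3]
    rw [h2, abs_of_nonneg]
    have := (norm_nonneg _).trans (h x hx)
    rw [← mul_div_assoc, pow_succ, ← mul_assoc]
    positivity
  · intro y hy
    refine h y ?_
    rcases le_total 0 x with h0 | h0
    · rw [uIoc_of_le h0] at hy
      rw [abs_of_nonneg h0] at hx
      rw [abs_of_pos hy.1]; exact hy.2.trans hx
    · rw [uIoc_of_ge h0] at hy
      rw [abs_of_nonpos h0] at hx
      rw [abs_of_nonpos hy.2]; linarith [hy.1]
  · exact (Continuous.intervalIntegrable (by fun_prop) _ _)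

theorem norm_picardTerm_le (lam : ℂ) {R : ℝ} (hR : 0 ≤ R) (n : ℕ) :
    ∀ x : ℝ, |x| ≤ R → ‖picardTerm lam n x‖ ≤ (‖lam‖ * R) ^ n / n.factorial * |x| ^ n := by
  induction n with
  | zero => intro x _; simp [picardTerm]
  | succ n ih =>
    intro x hx
    have key : ∀ y, |y| ≤ R → ‖-lam / (1 + (y : ℂ) ^ 2) * ∫ z in (0 : ℝ)..y, picardTerm lam n z‖
        ≤ (‖lam‖ * R) ^ (n + 1) / n.factorial * |y| ^ n := by
      intro y hy
      have h1 : ‖-lam / (1 + (y : ℂ) ^ 2)‖ ≤ ‖lam‖ := by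
        rw [norm_div, norm_neg]
        refine div_le_self (norm_nonneg _) ?_
        have : (1 : ℂ) + (y : ℂ) ^ 2 = ((1 + y ^ 2 : ℝ) : ℂ) := by push_cast; ring
        rw [this, Complex.norm_real, Real.norm_of_nonneg (by positivity)]
        nlinarith [sq_nonneg y]
      have h2 := norm_integral_le_of_pow ih hy
      have h3 : |y| ^ (n + 1) / ((n : ℝ) + 1) ≤ R * |y| ^ n := by
        refine (div_le_self (by positivity) (by linarith [(Nat.cast_nonneg n : (0 : ℝ) ≤ n)])).trans ?_
        rw [pow_succ, mul_comm]
        gcongr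
      rw [norm_mul]
      calc _ ≤ ‖lam‖ * ((‖lam‖ * R) ^ n / n.factorial * (R * |y| ^ n)) := by gcongr; exact h2.trans (by gcongr)
        _ = _ := by ring
    have := norm_integral_le_of_pow key hx
    refine this.trans_eq ?_
    rw [Nat.factorial_succ]
    push_cast
    field_simp

theorem norm_picardPrim_le (lam : ℂ) {R : ℝ} (hR : 0 ≤ R) (n : ℕ) {x : ℝ} (hx : |x| ≤ R) :
    ‖picardPrim lam n x‖ ≤ R * ((‖lam‖ * R * R) ^ n / n.factorial) := by
  have h2 := norm_integral_le_of_pow (norm_picardTerm_le lam hR n) hx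
  refine h2.trans ?_
  have h3 : |x| ^ (n + 1) / ((n : ℝ) + 1) ≤ R ^ (n + 1) :=
    (div_le_self (by positivity) (by linarith [(Nat.cast_nonneg n : (0 : ℝ) ≤ n)])).trans
      (by gcongr)
  calc _ ≤ (‖lam‖ * R) ^ n / n.factorial * R ^ (n + 1) := by gcongr
    _ = _ := by rw [mul_pow (‖lam‖ * R), pow_succ]; ring

theorem exists_isXi (lam : ℂ) : ∃ ξ : ℝ → ℂ, IsXi lam ξ := by
  have hT0 : ∀ n, picardTerm lam (n + 1) 0 = 0 := fun n => by simp [picardTerm]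
  have hP0 : ∀ n, picardPrim lam n 0 = 0 := fun n => by simp [picardPrim]
  have hT : ∀ R : ℝ, 0 < R → ∀ x ∈ Metric.ball (0 : ℝ) R, ∀ n,
      ‖picardTerm lam n x‖ ≤ (‖lam‖ * R * R) ^ n / n.factorial := by
    intro R hR x hx n
    have hx' : |x| ≤ R := by simpa using (Metric.mem_ball.1 hx).le
    refine (norm_picardTerm_le lam hR.le n x hx').trans ?_
    calc _ ≤ (‖lam‖ * R) ^ n / n.factorial * R ^ n := by gcongr
      _ = _ := by rw [mul_pow (‖lam‖ * R)]; ring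
  have hs : ∀ R : ℝ, Summable fun n : ℕ => (‖lam‖ * R * R) ^ n / (n.factorial : ℝ) :=
    fun R => Real.summable_pow_div_factorial _
  -- the primitive of the sum
  have hH : ∀ x : ℝ, HasDerivAt (fun x => ∑' n, picardPrim lam n x)
      (∑' n, picardTerm lam n x) x := by
    intro x
    have hR : 0 < |x| + 1 := by positivity
    refine hasDerivAt_tsum_of_isPreconnected (hs (|x| + 1)) Metric.isOpen_ball
      (convex_ball (0 : ℝ) (|x| + 1)).isPreconnected
      (fun n y _ => hasDerivAt_picardPrim lam n y) (fun n y hy => hT _ hR y hy n)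
      (Metric.mem_ball_self hR) (by simp [hP0, summable_zero]) (by simp)
  have hG : ∀ x : ℝ, HasDerivAt (fun x => 1 + ∑' n, picardTerm lam (n + 1) x)
      (-lam / (1 + (x : ℂ) ^ 2) * ∑' n, picardPrim lam n x) x := by
    intro x
    have hR : 0 < |x| + 1 := by positivity
    rw [← tsum_mul_left]
    refine (hasDerivAt_tsum_of_isPreconnected
      (((hs (|x| + 1)).mul_left (|x| + 1)).mul_left ‖lam‖) Metric.isOpen_ball
      (convex_ball (0 : ℝ) (|x| + 1)).isPreconnected
      (fun n y _ => hasDerivAt_picardTerm_succ lam n y) (fun n y hy => ?_)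
      (Metric.mem_ball_self hR) (by simp [hT0, summable_zero]) (by simp)).const_add 1
    have hy' : |y| ≤ |x| + 1 := by simpa using (Metric.mem_ball.1 hy).le
    rw [norm_mul]
    gcongr
    · rw [norm_div, norm_neg]
      refine div_le_self (norm_nonneg _) ?_
      have : (1 : ℂ) + (y : ℂ) ^ 2 = ((1 + y ^ 2 : ℝ) : ℂ) := by push_cast; ring
      rw [this, Complex.norm_real, Real.norm_of_nonneg (by positivity)]
      nlinarith [sq_nonneg y]
    · exact norm_picardPrim_le lam hR.le n hy'
  have hGsum : ∀ x : ℝ, ∑' n, picardTerm lam n x = 1 + ∑' n, picardTerm lam (n + 1) x := by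
    intro x
    have hR : 0 < |x| + 1 := by positivity
    have hsum : Summable fun n => picardTerm lam n x :=
      Summable.of_norm_bounded (hs (|x| + 1)) (fun n => hT _ hR x (by simp) n)
    rw [hsum.tsum_eq_zero_add]
    rfl
  refine ⟨fun v => 1 + ∑' n, picardTerm lam (n + 1) (Real.tan v),
    fun v => -lam * ∑' n, picardPrim lam n (Real.tan v), fun v hv => ?_, ?_, ?_⟩
  · have hc : Real.cos v ≠ 0 := (Real.cos_pos_of_mem_Ioo ⟨hv.1, hv.2⟩).ne'
    have hc' : (Real.cos v : ℂ) ≠ 0 := by exact_mod_cast hc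
    have ht := Real.hasDerivAt_tan hc
    have htan : (1 : ℂ) + (Real.tan v : ℂ) ^ 2 = 1 / (Real.cos v : ℂ) ^ 2 := by
      have := Real.inv_one_add_tan_sq hc
      have h2 : 1 + Real.tan v ^ 2 = 1 / Real.cos v ^ 2 := by rw [one_div, ← this, inv_inv]
      exact_mod_cast congrArg (fun r : ℝ => (r : ℂ)) h2
    constructor
    · refine ((hG (Real.tan v)).scomp v ht).congr_deriv ?_
      rw [htan, Complex.real_smul]
      simp only [Complex.ofReal_div, Complex.ofReal_one, Complex.ofReal_pow]
      field_simp
    · refine (((hH (Real.tan v)).scomp v ht).const_mul (-lam)).congr_deriv ?_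
      rw [hGsum, Complex.real_smul]
      push_cast
      ring
  · simp [hT0]
  · simp [hP0]

/-- The solution `ξ_λ` of the initial value problem `IsXi` (it is unique on `(-π/2, π/2)`). -/
def xi (lam : ℂ) : ℝ → ℂ := Classical.choose (exists_isXi lam)

/-! ### The Huber transform and the test function -/

/-- The Huber transform
`d(f, t) = ∫_0^{π/2} f(1 / cos² v) ξ_λ(v) / cos² v dv`, with `λ = 1/4 + t²`. -/
def huberTransform (f : ℝ → ℝ) (t : ℂ) : ℂ :=
  ∫ v in (0 : ℝ)..(Real.pi / 2),
    (f (1 / Real.cos v ^ 2) : ℂ) * (xi (1 / 4 + t ^ 2) v / (Real.cos v : ℂ) ^ 2)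

/-- The function of `x ≥ 0` that is `1` for `x ≤ U`, `0` for `x ≥ V`, and linear on `[U, V]`. -/
def ramp (U V x : ℝ) : ℝ :=
  if x ≤ U then 1 else if x ≤ V then (V - x) / (V - U) else 0

/-- The test function `f⁺` on `[1, ∞)`: `f⁺(x² + 1) = ramp U V x` for `x ≥ 0`, where
`U = √(X² - 1)` and `V = U + Y`. -/
def fPlus (X Y : ℝ) (w : ℝ) : ℝ :=
  ramp (Real.sqrt (X ^ 2 - 1)) (Real.sqrt (X ^ 2 - 1) + Y) (Real.sqrt (w - 1))

/-- The coefficient `B(s)`. -/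
def coeffB (s : ℂ) : ℂ :=
  2 ^ (s - 2) *
    (Complex.exp (Complex.I * (Real.pi / 2) * (s - 1)) +
      Complex.exp (-Complex.I * (Real.pi / 2) * (s - 1))) *
    (Complex.Gamma ((s + 1) / 2) * Complex.Gamma (1 - s / 2) * Complex.Gamma (s - 1 / 2) /
      (Real.pi * Complex.Gamma (s + 2)))

/-- The coefficient `D(s)`. -/
def coeffD (s : ℂ) : ℂ :=
  (Complex.exp (Complex.I * (Real.pi / 2) * (-s)) +
      Complex.exp (-Complex.I * (Real.pi / 2) * (-s))) *
    (Complex.Gamma ((s + 1) / 2) * Complex.Gamma (1 - s / 2) * Complex.Gamma (1 / 2 - s) /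
      (Real.pi * Complex.Gamma (3 - s) * 2 ^ (s + 1)))

/-- The admissible parameters `X, Y`: `X ≥ 2` and, with `U = √(X² - 1)`, `V = U + Y`,
one has `U < V < 2U`. -/
def Admissible (X Y : ℝ) : Prop :=
  2 ≤ X ∧ 0 < Y ∧ Y < Real.sqrt (X ^ 2 - 1)

/-- The parameters `t` for which `s = 1/2 + it` either lies on the line `Re s = 1/2`, or is real
with `1/2 < s ≤ 1`; the point `t = 0` is excluded. -/
def SpectralParam (t : ℂ) : Prop :=
  (t.im = 0 ∧ t ≠ 0) ∨ (t.re = 0 ∧ 1 / 2 < 1 / 2 - t.im ∧ 1 / 2 - t.im ≤ 1)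

end Huber

end

noncomputable section

namespace Huber

/-! ### Power series with coefficients of polynomial growth -/

/-! In the variable x = tan v, let H be the primitive of ξ_λ with H(0) = 0. It solves (1 + x²)H'' +
λH = 0 with H'(0) = 1, and integration by parts against the piecewise linear cutoff turns d(f⁺, t)
into the mean of H over [U, V] (`huberTransform_fPlus`). What remains is the behaviour of H at
infinity.

Write μ = it, so λ = 1/4 − μ². For large x the equation is close to Euler's equation x²H'' + λH = 0,
with solutions x^(1/2 ± μ). The substitution x = sinh u, H = √(cosh u)·w gives the Pöschl–Teller
equation w'' + (3/4)sech²(u)·w = μ²w, which is solved exactly by e^(μu) times ₂F₁(−1/2, 3/2; 1 − μ;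
(1 − tanh u)/2). This yields solutions `jost (±μ)` asymptotic to x^(1/2 ± μ) (`isSol_jost`,
`norm_jost_sub_le`). Their Wronskian is −2μ, so for μ ≠ 0 H is `amp μ * jost μ + amp (-μ) * jost
(-μ)`, with amplitudes read off at x = 0 (`IsSol.eq_jost`). There the hypergeometric argument is
1/2, and since −1/2 + 3/2 = 1 Bailey's summation applies (`hyp_half`); Gamma identities turn the
amplitudes into B(s)(s+1) and D(s)(2−s).

Part (a) averages the asymptotics. Part (c) is (a) together with B(s), D(s) ≪ 1/(s − 1/2) and the
poles of Γ at 0. In (b), μ is imaginary: the bound by |t| is the trivial estimate of the mean, while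
the bound by X/Y comes from an explicit primitive of any solution (`IsSol.integral_eq`); the main
term is the mean of a pure power over [X, X + Y]. In (d) the two exponents coincide, and a
perturbation argument around √x and √x·log x replaces the connection formula
(`exists_abs_le_of_ode`). -/

theorem summable_mul_pow_of_growth {a : ℕ → ℂ} {C : ℝ} {k : ℕ}
    (ha : ∀ n, ‖a n‖ ≤ C * ((n : ℝ) + 1) ^ k) {ρ : ℝ} (h0 : 0 ≤ ρ) (h1 : ρ < 1) :
    Summable fun n => ‖a n‖ * ρ ^ n := by
  -- The comparison series below carries a factor 1/ρ from an index shift, so ρ = 0 is treated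
  -- apart.
  rcases h0.eq_or_lt with rfl | h0
  · refine summable_of_ne_finset_zero (s := {0}) fun n hn => ?_
    rw [zero_pow (by simpa using hn), mul_zero]
  have hs := (summable_nat_add_iff 1).2 (summable_pow_mul_geometric_of_norm_lt_one k
    (r := ρ) (by rwa [Real.norm_of_nonneg h0.le]))
  refine Summable.of_nonneg_of_le (fun n => by positivity) (fun n => ?_) (hs.mul_left (C / ρ))
  calc ‖a n‖ * ρ ^ n ≤ C * ((n : ℝ) + 1) ^ k * ρ ^ n := by gcongr; exact ha n
    _ = _ := by push_cast; rw [pow_succ]; field_simp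

theorem summable_of_growth {a : ℕ → ℂ} {C : ℝ} {k : ℕ}
    (ha : ∀ n, ‖a n‖ ≤ C * ((n : ℝ) + 1) ^ k) {z : ℂ} (hz : ‖z‖ < 1) :
    Summable fun n => a n * z ^ n :=
  Summable.of_norm (by simpa using summable_mul_pow_of_growth ha (norm_nonneg z) hz)

theorem growth_deriv {a : ℕ → ℂ} {C : ℝ} {k : ℕ}
    (ha : ∀ n, ‖a n‖ ≤ C * ((n : ℝ) + 1) ^ k) (n : ℕ) :
    ‖((n : ℂ) + 1) * a (n + 1)‖ ≤ C * 2 ^ k * ((n : ℝ) + 1) ^ (k + 1) := by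
  have hC : 0 ≤ C := by simpa using (norm_nonneg _).trans (ha 0)
  have h1 : ‖(n : ℂ) + 1‖ = (n : ℝ) + 1 := by
    rw [← Nat.cast_succ, Complex.norm_natCast]; push_cast; ring
  rw [norm_mul, h1]
  calc ((n : ℝ) + 1) * ‖a (n + 1)‖ ≤ ((n : ℝ) + 1) * (C * (((n + 1 : ℕ) : ℝ) + 1) ^ k) := by
        gcongr; exact ha _
    _ ≤ ((n : ℝ) + 1) * (C * (2 * ((n : ℝ) + 1)) ^ k) := by
        gcongr
        push_cast; linarith [(Nat.cast_nonneg n : (0 : ℝ) ≤ n)]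
    _ = _ := by rw [mul_pow]; ring

theorem hasDerivAt_tsum_pow {a : ℕ → ℂ} {C : ℝ} {k : ℕ}
    (ha : ∀ n, ‖a n‖ ≤ C * ((n : ℝ) + 1) ^ k) {z : ℂ} (hz : ‖z‖ < 1) :
    HasDerivAt (fun z => ∑' n, a n * z ^ n) (∑' n : ℕ, ((n : ℂ) + 1) * a (n + 1) * z ^ n) z := by
  obtain ⟨ρ, hρ, hρ1⟩ := exists_between hz
  have hρ0 : 0 < ρ := (norm_nonneg z).trans_lt hρ
  have hs : Summable fun n : ℕ => ‖a n‖ * (n * ρ ^ (n - 1)) := by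
    rw [← summable_nat_add_iff 1]
    refine (summable_mul_pow_of_growth (growth_deriv ha) hρ0.le hρ1).congr fun n => ?_
    have h1 : ‖(n : ℂ) + 1‖ = (n : ℝ) + 1 := by
      rw [← Nat.cast_succ, Complex.norm_natCast]; push_cast; ring
    rw [norm_mul, h1, Nat.add_sub_cancel]; push_cast; ring
  have h := hasDerivAt_tsum_of_isPreconnected (g := fun n z => a n * z ^ n)
    (g' := fun n z => a n * (n * z ^ (n - 1))) (y₀ := 0) hs Metric.isOpen_ball
    (convex_ball (0 : ℂ) ρ).isPreconnected
    (fun n y _ => (hasDerivAt_pow n y).const_mul (a n)) (fun n y hy => ?_)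
    (Metric.mem_ball_self hρ0) (summable_of_growth ha (by simp)) (by simpa using hρ)
  · refine h.congr_deriv ?_
    have hs' : Summable fun n : ℕ => a n * (n * z ^ (n - 1)) := by
      refine Summable.of_norm_bounded hs fun n => ?_
      rw [norm_mul, norm_mul, norm_pow, Complex.norm_natCast]; gcongr
    rw [hs'.tsum_eq_zero_add]
    simp only [Nat.cast_zero, zero_mul, mul_zero, zero_add]
    refine tsum_congr fun n => ?_
    rw [Nat.add_sub_cancel]; push_cast; ring
  · have hy' : ‖y‖ ≤ ρ := by simpa using (Metric.mem_ball.1 hy).le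
    rw [norm_mul, norm_mul, norm_pow, Complex.norm_natCast]; gcongr

/-! ### The hypergeometric function `₂F₁(-1/2, 3/2; 1 - μ; z)` -/

/-- The coefficients of `₂F₁(-1/2, 3/2; 1 - μ; z)`. -/
def hypCoeff (μ : ℂ) : ℕ → ℂ
  | 0 => 1
  | n + 1 => ((n : ℂ) - 1 / 2) * (n + 3 / 2) / ((n + 1) * (n + 1 - μ)) * hypCoeff μ n

/-- The hypergeometric function `₂F₁(-1/2, 3/2; 1 - μ; z)`. -/
def hyp (μ z : ℂ) : ℂ := ∑' n, hypCoeff μ n * z ^ n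

/-- The derivative of `hyp μ`. -/
def hypDeriv (μ z : ℂ) : ℂ := ∑' n : ℕ, ((n : ℂ) + 1) * hypCoeff μ (n + 1) * z ^ n

theorem norm_sub_ge {μ : ℂ} (hμ : μ.re ≤ 1 / 2) (n : ℕ) : (n : ℝ) + 1 / 2 ≤ ‖(n : ℂ) + 1 - μ‖ := by
  have h := Complex.re_le_norm ((n : ℂ) + 1 - μ)
  simp at h
  linarith

theorem sub_ne_zero_of_re {μ : ℂ} (hμ : μ.re ≤ 1 / 2) (n : ℕ) : (n : ℂ) + 1 - μ ≠ 0 := by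
  have := norm_sub_ge hμ n
  have h0 : (0 : ℝ) ≤ n := Nat.cast_nonneg n
  exact norm_pos_iff.1 (by linarith)

theorem hypCoeff_rec {μ : ℂ} (hμ : μ.re ≤ 1 / 2) (n : ℕ) :
    ((n : ℂ) + 1) * (n + 1 - μ) * hypCoeff μ (n + 1) =
      ((n : ℂ) - 1 / 2) * (n + 3 / 2) * hypCoeff μ n := by
  have h1 := sub_ne_zero_of_re hμ n
  have h2 : (n : ℂ) + 1 ≠ 0 := Nat.cast_add_one_ne_zero n
  rw [hypCoeff]
  field_simp

/-- After the first step the ratios of consecutive coefficients have modulus at most 1, so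
everything is dominated by the coefficient of index 1. Keeping 1/‖1 − μ‖ is what forces `hyp` to 1
when μ is shifted to −∞ in `tendsto_hyp_half`. -/
theorem norm_hypCoeff_succ_le {μ : ℂ} (hμ : μ.re ≤ 1 / 2) (n : ℕ) :
    ‖hypCoeff μ (n + 1)‖ ≤ 3 / 4 / ‖1 - μ‖ := by
  induction n with
  | zero => simp [hypCoeff]; norm_num
  | succ n ih =>
    rw [hypCoeff]
    refine (norm_mul_le _ _).trans ((mul_le_of_le_one_left (norm_nonneg _) ?_).trans ih)
    have h1 := norm_sub_ge hμ (n + 1)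
    have h0 : (0 : ℝ) ≤ n := Nat.cast_nonneg n
    have e1 : ‖((n + 1 : ℕ) : ℂ) - 1 / 2‖ = (n : ℝ) + 1 / 2 := by
      rw [show ((n + 1 : ℕ) : ℂ) - 1 / 2 = (((n : ℝ) + 1 / 2 : ℝ) : ℂ) by push_cast; ring,
        Complex.norm_real, Real.norm_of_nonneg (by positivity)]
    have e2 : ‖((n + 1 : ℕ) : ℂ) + 3 / 2‖ = (n : ℝ) + 5 / 2 := by
      rw [show ((n + 1 : ℕ) : ℂ) + 3 / 2 = (((n : ℝ) + 5 / 2 : ℝ) : ℂ) by push_cast; ring,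
        Complex.norm_real, Real.norm_of_nonneg (by positivity)]
    have e3 : ‖((n + 1 : ℕ) : ℂ) + 1‖ = (n : ℝ) + 2 := by
      rw [show ((n + 1 : ℕ) : ℂ) + 1 = (((n : ℝ) + 2 : ℝ) : ℂ) by push_cast; ring,
        Complex.norm_real, Real.norm_of_nonneg (by positivity)]
    rw [norm_div, norm_mul, norm_mul, e1, e2, e3]
    push_cast at h1 ⊢
    refine (div_le_one (mul_pos (by positivity) (lt_of_lt_of_le (by positivity) h1))).2 ?_
    nlinarith

theorem norm_one_sub_ge {μ : ℂ} (hμ : μ.re ≤ 1 / 2) : 1 / 2 ≤ ‖1 - μ‖ := by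
  simpa using norm_sub_ge hμ 0

theorem norm_hypCoeff_le {μ : ℂ} (hμ : μ.re ≤ 1 / 2) (n : ℕ) : ‖hypCoeff μ n‖ ≤ 3 / 2 := by
  cases n with
  | zero => simp [hypCoeff]; norm_num
  | succ n =>
    refine (norm_hypCoeff_succ_le hμ n).trans ?_
    have := norm_one_sub_ge hμ
    rw [div_le_iff₀ (by linarith)]
    linarith

theorem hypCoeff_growth {μ : ℂ} (hμ : μ.re ≤ 1 / 2) (n : ℕ) :
    ‖hypCoeff μ n‖ ≤ 3 / 2 * ((n : ℝ) + 1) ^ 0 := by simpa using norm_hypCoeff_le hμ n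

theorem hasDerivAt_hyp {μ : ℂ} (hμ : μ.re ≤ 1 / 2) {z : ℂ} (hz : ‖z‖ < 1) :
    HasDerivAt (hyp μ) (hypDeriv μ z) z :=
  hasDerivAt_tsum_pow (hypCoeff_growth hμ) hz

/-- The hypergeometric differential equation. -/
theorem exists_hasDerivAt_hypDeriv {μ : ℂ} (hμ : μ.re ≤ 1 / 2) {z : ℂ} (hz : ‖z‖ < 1) :
    ∃ w : ℂ, HasDerivAt (hypDeriv μ) w z ∧
      z * (1 - z) * w + (1 - μ - 2 * z) * hypDeriv μ z + 3 / 4 * hyp μ z = 0 := by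
  have g1 := growth_deriv (hypCoeff_growth hμ)
  refine ⟨_, hasDerivAt_tsum_pow g1 hz, ?_⟩
  have g2 := growth_deriv g1
  have s0 := (summable_of_growth (hypCoeff_growth hμ) hz).hasSum
  have s1 := (summable_of_growth g1 hz).hasSum
  have s2 := (summable_of_growth g2 hz).hasSum
  -- Multiplication by z is an index shift. All terms of the equation become series in z^n, and
  -- comparing coefficients leaves exactly `hypCoeff_rec`.
  have shift : ∀ (b : ℕ → ℂ) (S : ℂ), HasSum (fun n => b (n + 1) * z ^ n) S → b 0 = 0 →
      HasSum (fun n => b n * z ^ n) (z * S) := by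
    intro b S h hb
    rw [← hasSum_nat_add_iff' 1]
    simp only [Finset.range_one, Finset.sum_singleton, hb, zero_mul, sub_zero]
    refine (h.mul_left z).congr_fun fun n => ?_
    simp only [pow_succ]; ring
  have t1 := shift (fun n => (n : ℂ) * hypCoeff μ n) _ (by simpa using s1) (by simp)
  have t2 := shift (fun n => (n : ℂ) * (((n : ℂ) + 1) * hypCoeff μ (n + 1))) _
    (by simpa using s2) (by simp)
  have t3 := shift (fun n => (n : ℂ) * ((n : ℂ) - 1) * hypCoeff μ n) _
    (t2.congr_fun fun n => by push_cast; ring) (by simp)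
  have hsum := ((((t2.sub t3).add (s1.mul_left (1 - μ))).sub (t1.mul_left 2)).add
    (s0.mul_left (3 / 4)))
  have hzero := hsum.unique (hasSum_zero.congr_fun fun n => ?_)
  · rw [← hzero]
    simp only [hyp, hypDeriv]
    push_cast; ring
  · have := hypCoeff_rec hμ n
    linear_combination (z ^ n) * this

theorem norm_hyp_sub_one_le {μ : ℂ} (hμ : μ.re ≤ 1 / 2) {z : ℂ} (hz : ‖z‖ ≤ 1 / 2) :
    ‖hyp μ z - 1‖ ≤ 3 / 2 / ‖1 - μ‖ * ‖z‖ := by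
  have hs := summable_of_growth (hypCoeff_growth hμ) (lt_of_le_of_lt hz (by norm_num))
  have h1 : hyp μ z - 1 = ∑' n, hypCoeff μ (n + 1) * z ^ (n + 1) := by
    rw [hyp, hs.tsum_eq_zero_add]; simp [hypCoeff]
  rw [h1]
  have hg := (hasSum_geometric_of_lt_one (norm_nonneg z)
    (lt_of_le_of_lt hz (by norm_num))).mul_left (3 / 4 / ‖1 - μ‖ * ‖z‖)
  refine (tsum_of_norm_bounded hg fun n => ?_).trans ?_
  · rw [norm_mul, norm_pow, pow_succ]
    calc _ ≤ 3 / 4 / ‖1 - μ‖ * (‖z‖ ^ n * ‖z‖) := by gcongr; exact norm_hypCoeff_succ_le hμ n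
      _ = _ := by ring
  · have h2 : (1 - ‖z‖)⁻¹ ≤ 2 := by
      rw [inv_le_comm₀ (by linarith) (by norm_num)]; linarith
    calc _ ≤ 3 / 4 / ‖1 - μ‖ * ‖z‖ * 2 := by gcongr
      _ = _ := by ring

theorem norm_hyp_sub_one_le' {μ : ℂ} (hμ : μ.re ≤ 1 / 2) {z : ℂ} (hz : ‖z‖ ≤ 1 / 2) :
    ‖hyp μ z - 1‖ ≤ 3 * ‖z‖ := by
  refine (norm_hyp_sub_one_le hμ hz).trans ?_
  gcongr
  have := norm_one_sub_ge hμ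
  rw [div_le_iff₀ (by linarith)]
  linarith

theorem norm_hyp_le {μ : ℂ} (hμ : μ.re ≤ 1 / 2) {z : ℂ} (hz : ‖z‖ ≤ 1 / 2) : ‖hyp μ z‖ ≤ 3 := by
  have h1 := norm_hyp_sub_one_le' hμ hz
  have h2 := norm_add_le (hyp μ z - 1) 1
  simp at h2
  linarith

theorem norm_hypDeriv_le {μ : ℂ} (hμ : μ.re ≤ 1 / 2) {z : ℂ} (hz : ‖z‖ ≤ 1 / 2) :
    ‖hypDeriv μ z‖ ≤ 6 := by
  have hg := (hasSum_coe_mul_geometric_of_norm_lt_one (r := (1 / 2 : ℝ)) (by norm_num)).add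
    (hasSum_geometric_of_norm_lt_one (ξ := (1 / 2 : ℝ)) (by norm_num))
  refine (tsum_of_norm_bounded (hg.mul_left (3 / 2)) fun n => ?_).trans (by norm_num)
  have h1 : ‖(n : ℂ) + 1‖ = (n : ℝ) + 1 := by
    rw [← Nat.cast_succ, Complex.norm_natCast]; push_cast; ring
  rw [norm_mul, norm_mul, norm_pow, h1]
  calc _ ≤ ((n : ℝ) + 1) * (3 / 2) * (1 / 2) ^ n := by gcongr; exact norm_hypCoeff_le hμ _
    _ = _ := by ring

/-! ### The value of the hypergeometric function at `1/2` -/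

/-- Only the Pochhammer symbol (1 − μ)_n in the denominator depends on μ, and all but two factors at
each end are common to (1 − μ)_n and (3 − μ)_n. -/
theorem hypCoeff_sub_two {μ : ℂ} (hμ : μ.re ≤ 1 / 2) (n : ℕ) :
    hypCoeff (μ - 2) n * ((n + 1 - μ) * (n + 2 - μ)) = hypCoeff μ n * ((1 - μ) * (2 - μ)) := by
  have hμ2 : (μ - 2).re ≤ 1 / 2 := by simp; linarith
  induction n with
  | zero => simp [hypCoeff]
  | succ n ih =>
    have h1 := hypCoeff_rec hμ n
    have h2 := hypCoeff_rec hμ2 n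
    have n1 : (n : ℂ) + 1 ≠ 0 := Nat.cast_add_one_ne_zero n
    have n2 := sub_ne_zero_of_re hμ n
    have n3 := sub_ne_zero_of_re hμ2 n
    have n4 : (n : ℂ) + 1 - (μ - 2) = n + 3 - μ := by ring
    rw [n4] at h2 n3
    push_cast
    refine mul_left_cancel₀ (mul_ne_zero n1 n2) ?_
    linear_combination (n + 1 - μ) * (n + 2 - μ) * h2 - (1 - μ) * (2 - μ) * h1 +
      ((n : ℂ) - 1 / 2) * (n + 3 / 2) * ih

/-- A contiguous relation special to z = 1/2. With c_n = `hypCoeff μ n` and T_n = n·c_n·2^(−n)/(n +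
1 − μ), the n-th terms of the two sides differ by a constant multiple of T_(n+1) − T_n; the sum
telescopes to zero because T_0 = 0. -/
theorem hyp_half_rec {μ : ℂ} (hμ : μ.re ≤ 1 / 2) :
    (1 - μ) * (2 - μ) * hyp μ (1 / 2) =
      (1 / 2 - μ) * (5 / 2 - μ) * hyp (μ - 2) (1 / 2) := by
  have hμ2 : (μ - 2).re ≤ 1 / 2 := by simp; linarith
  have hz : ‖(1 / 2 : ℂ)‖ < 1 := by norm_num
  have s0 := (summable_of_growth (hypCoeff_growth hμ) hz).hasSum
  have s2 := (summable_of_growth (hypCoeff_growth hμ2) hz).hasSum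
  have hT : Summable fun n : ℕ => (n : ℂ) * hypCoeff μ n / (n + 1 - μ) * (1 / 2) ^ n := by
    refine summable_of_growth (C := 3 / 2) (k := 0) (fun n => ?_) hz
    have h0 := norm_sub_ge hμ n
    have h1 : (0 : ℝ) ≤ n := Nat.cast_nonneg n
    rw [norm_div, norm_mul, Complex.norm_natCast, pow_zero, mul_one, div_le_iff₀ (by linarith),
      mul_comm]
    gcongr
    · exact norm_hypCoeff_le hμ n
    · linarith
  have hT1 := (hasSum_nat_add_iff' 1).2 hT.hasSum
  simp only [Finset.range_one, Finset.sum_singleton, Nat.cast_zero, zero_mul, zero_div,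
    sub_zero] at hT1
  have hd := (hT1.sub hT.hasSum).mul_left (-2 * (1 - μ) * (2 - μ))
  rw [sub_self, mul_zero] at hd
  have hsum := (s0.mul_left ((1 - μ) * (2 - μ))).sub (s2.mul_left ((1 / 2 - μ) * (5 / 2 - μ)))
  refine sub_eq_zero.1 (hsum.unique (hd.congr_fun fun n => ?_))
  have e1 := hypCoeff_sub_two hμ n
  have e2 := hypCoeff_rec hμ n
  have n1 := sub_ne_zero_of_re hμ n
  have n2 : (n : ℂ) + 2 - μ ≠ 0 := by
    have := sub_ne_zero_of_re hμ (n + 1)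
    push_cast at this
    convert this using 1; ring
  have n3 : ((n + 1 : ℕ) : ℂ) + 1 - μ = n + 2 - μ := by push_cast; ring
  rw [n3]
  have e3 : hypCoeff (μ - 2) n =
      hypCoeff μ n * ((1 - μ) * (2 - μ)) / ((n + 1 - μ) * (n + 2 - μ)) := by
    rw [← e1]; field_simp
  have e4 : ((n : ℂ) + 1) * hypCoeff μ (n + 1) =
      ((n : ℂ) - 1 / 2) * (n + 3 / 2) * hypCoeff μ n / (n + 1 - μ) := by
    rw [← e2]; field_simp
  rw [e3]
  push_cast
  rw [e4, pow_succ]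
  field_simp
  ring

/-- Iteration of `hyp_half_rec`, with every linear factor halved so that the products become the
denominators in Euler's limit for Γ (`Complex.GammaSeq`). -/
theorem hyp_half_prod {μ : ℂ} (hμ : μ.re ≤ 1 / 2) (m : ℕ) :
    (∏ j ∈ Finset.range m, ((1 - μ) / 2 + j)) * (∏ j ∈ Finset.range m, (1 - μ / 2 + j)) *
        hyp μ (1 / 2) =
      (∏ j ∈ Finset.range m, (1 / 4 - μ / 2 + j)) * (∏ j ∈ Finset.range m, (5 / 4 - μ / 2 + j)) *
        hyp (μ - 2 * m) (1 / 2) := by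
  induction m with
  | zero => simp
  | succ m ih =>
    have hμ2 : (μ - 2 * m).re ≤ 1 / 2 := by
      simp; linarith [(Nat.cast_nonneg m : (0 : ℝ) ≤ m)]
    have h := hyp_half_rec hμ2
    have e : μ - 2 * ((m + 1 : ℕ) : ℂ) = μ - 2 * m - 2 := by push_cast; ring
    simp only [Finset.prod_range_succ, e]
    linear_combination ((1 - μ) / 2 + m) * (1 - μ / 2 + m) * ih +
      (∏ j ∈ Finset.range m, (1 / 4 - μ / 2 + (j : ℂ))) *
      (∏ j ∈ Finset.range m, (5 / 4 - μ / 2 + (j : ℂ))) / 4 * h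

/-- The shift by m + 1 instead of m matches the m + 1 factors in the denominator of
`Complex.GammaSeq`. -/
theorem tendsto_hyp_half {μ : ℂ} (hμ : μ.re ≤ 1 / 2) :
    Filter.Tendsto (fun m : ℕ => hyp (μ - 2 * ((m + 1 : ℕ) : ℂ)) (1 / 2)) Filter.atTop (nhds 1) := by
  rw [tendsto_iff_norm_sub_tendsto_zero]
  have hlim : Filter.Tendsto (fun m : ℕ => (3 / 4 : ℝ) / (m : ℝ)) Filter.atTop (nhds 0) :=
    tendsto_const_div_atTop_nhds_zero_nat _
  refine tendsto_of_tendsto_of_tendsto_of_le_of_le' tendsto_const_nhds hlim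
    (Filter.Eventually.of_forall fun _ => norm_nonneg _) ?_
  filter_upwards [Filter.eventually_ge_atTop 1] with m hm
  have hm' : (1 : ℝ) ≤ m := by exact_mod_cast hm
  have hμ2 : (μ - 2 * ((m + 1 : ℕ) : ℂ)).re ≤ 1 / 2 := by simp; linarith
  refine (norm_hyp_sub_one_le hμ2 (by norm_num)).trans ?_
  have h1 := Complex.re_le_norm (1 - (μ - 2 * ((m + 1 : ℕ) : ℂ)))
  simp at h1
  have h2 : (m : ℝ) ≤ ‖1 - (μ - 2 * ((m + 1 : ℕ) : ℂ))‖ := by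
    push_cast; linarith
  calc _ ≤ 3 / 2 / (m : ℝ) * ‖(1 / 2 : ℂ)‖ := by gcongr
    _ = _ := by norm_num; ring

/-- The value of `₂F₁(-1/2, 3/2; 1 - μ; 1/2)`. -/
theorem hyp_half {μ : ℂ} (hμ : μ.re ≤ 1 / 2) (hμ' : μ ≠ 1 / 2) :
    Complex.Gamma (1 / 4 - μ / 2) * Complex.Gamma (5 / 4 - μ / 2) * hyp μ (1 / 2) =
      Complex.Gamma ((1 - μ) / 2) * Complex.Gamma (1 - μ / 2) := by
  have l1 := ((Complex.GammaSeq_tendsto_Gamma (1 / 4 - μ / 2)).mul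
    (Complex.GammaSeq_tendsto_Gamma (5 / 4 - μ / 2))).mul_const (hyp μ (1 / 2))
  have l2 := ((Complex.GammaSeq_tendsto_Gamma ((1 - μ) / 2)).mul
    (Complex.GammaSeq_tendsto_Gamma (1 - μ / 2))).mul (tendsto_hyp_half hμ)
  rw [mul_one] at l2
  refine tendsto_nhds_unique l1 (l2.congr' ?_)
  filter_upwards [Filter.eventually_ge_atTop 1] with n hn
  have hn' : (n : ℂ) ≠ 0 := by exact_mod_cast (by omega : n ≠ 0)
  have ne : ∀ w : ℂ, 0 < w.re → (∏ j ∈ Finset.range (n + 1), (w + j)) ≠ 0 := by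
    refine fun w hw => Finset.prod_ne_zero_iff.2 fun j _ h => ?_
    have := congrArg Complex.re h
    simp at this
    linarith [(Nat.cast_nonneg j : (0 : ℝ) ≤ j)]
  have p1 := ne ((1 - μ) / 2) (by simp; linarith)
  have p2 := ne (1 - μ / 2) (by simp; linarith)
  have p4 := ne (5 / 4 - μ / 2) (by simp; linarith)
  -- Here the real part of 1/4 − μ/2 is only nonnegative: a factor can vanish only for j = 0, and
  -- then μ = 1/2, which is excluded.
  have p3 : (∏ j ∈ Finset.range (n + 1), (1 / 4 - μ / 2 + (j : ℂ))) ≠ 0 := by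
    refine Finset.prod_ne_zero_iff.2 fun j _ h => ?_
    have h2 := congrArg Complex.re h
    simp at h2
    have h3 : (0 : ℝ) ≤ j := Nat.cast_nonneg j
    have h4 : j = 0 := by
      by_contra h0
      have : (1 : ℝ) ≤ j := by exact_mod_cast Nat.one_le_iff_ne_zero.2 h0
      linarith
    subst h4
    exact hμ' (by simp at h; linear_combination (-2) * h)
  have hp := hyp_half_prod hμ (n + 1)
  -- Both pairs of exponents add up to 3/2 − μ, so the powers of n cancel in the quotient of Gamma
  -- sequences.
  have hc : (n : ℂ) ^ (1 / 4 - μ / 2) * (n : ℂ) ^ (5 / 4 - μ / 2) =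
      (n : ℂ) ^ ((1 - μ) / 2) * (n : ℂ) ^ (1 - μ / 2) := by
    rw [← Complex.cpow_add _ _ hn', ← Complex.cpow_add _ _ hn']
    congr 1; ring
  simp only [Complex.GammaSeq]
  rw [div_mul_div_comm, div_mul_div_comm, div_mul_eq_mul_div, div_mul_eq_mul_div,
    div_eq_div_iff (mul_ne_zero p1 p2) (mul_ne_zero p3 p4)]
  linear_combination
    (-(n : ℂ) ^ ((1 - μ) / 2) * (n : ℂ) ^ (1 - μ / 2) * (n.factorial : ℂ) ^ 2) * hp -
    (n.factorial : ℂ) ^ 2 * hyp μ (1 / 2) * (∏ j ∈ Finset.range (n + 1), ((1 - μ) / 2 + (j : ℂ))) *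
      (∏ j ∈ Finset.range (n + 1), (1 - μ / 2 + (j : ℂ))) * hc

/-- The exceptional point s = 1, where Γ(1/4 − μ/2) has a pole. Then λ = 0 and H(x) = x, so the
second wave must be absent; the factor 1/2 − μ in the recurrence shows it. -/
theorem hyp_half_of_eq : hyp (1 / 2) (1 / 2) = 0 := by
  have h := hyp_half_rec (μ := 1 / 2) (by norm_num)
  rw [sub_self, zero_mul, zero_mul] at h
  have h2 : (1 - 1 / 2 : ℂ) * (2 - 1 / 2) ≠ 0 := by norm_num
  exact (mul_eq_zero.1 h).resolve_left h2

/-! ### The coefficients `B(s)` and `D(s)` -/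

theorem exp_add_exp_neg (w : ℂ) :
    Complex.exp (Complex.I * (Real.pi / 2) * w) + Complex.exp (-Complex.I * (Real.pi / 2) * w) =
      2 * Complex.cos (Real.pi / 2 * w) := by
  rw [Complex.two_cos]
  congr 2 <;> ring

theorem half_cpow (μ : ℂ) : (1 / 2 : ℂ) ^ μ = 2 ^ (-μ) := by
  rw [one_div, Complex.inv_cpow _ _ (by rw [Complex.ofNat_arg]; exact Real.pi_pos.ne),
    Complex.cpow_neg]

theorem Gamma_duplication (μ : ℂ) :
    Complex.Gamma ((1 + μ) / 2) * Complex.Gamma (1 + μ / 2) =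
      Complex.Gamma (1 + μ) * 2 ^ (-μ) * (√Real.pi : ℝ) := by
  have h := Complex.Gamma_mul_Gamma_add_half ((1 + μ) / 2)
  rw [show (1 + μ) / 2 + 1 / 2 = 1 + μ / 2 by ring, show 2 * ((1 + μ) / 2) = 1 + μ by ring,
    show 1 - (1 + μ) = -μ by ring] at h
  exact h

/-- The nonvanishing hypotheses exclude the zeros of the sine, where the convention a/0 = 0 would
spoil the product form. -/
theorem Gamma_reflection {w : ℂ} (h1 : Complex.Gamma w ≠ 0) (h2 : Complex.Gamma (1 - w) ≠ 0) :
    Complex.Gamma w * Complex.Gamma (1 - w) * Complex.sin (Real.pi * w) = Real.pi := by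
  have h := Complex.Gamma_mul_Gamma_one_sub w
  have hs : Complex.sin (Real.pi * w) ≠ 0 := by
    intro hs
    rw [hs, div_zero] at h
    exact mul_ne_zero h1 h2 h
  rw [h, div_mul_cancel₀ _ hs]

/-- The exponentials combine to 2·sin(π(1/4 + μ/2)), which reflection trades for Gamma factors;
duplication at μ and at 1/2 + μ, together with `hyp_half` at −μ, then cancels every Gamma value. -/
theorem coeffB_eq {μ : ℂ} (h1 : -(1 / 2) < μ.re) (h2 : μ.re ≤ 1 / 2) (h0 : μ ≠ 0) :
    coeffB (1 / 2 + μ) * (3 / 2 + μ) = 2 ^ μ * hyp (-μ) (1 / 2) / (2 * μ) := by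
  have hG : ∀ w : ℂ, 0 < w.re → Complex.Gamma w ≠ 0 := fun w hw => Complex.Gamma_ne_zero_of_re_pos hw
  have nc := hG (1 / 4 + μ / 2) (by simp; linarith)
  have ne := hG (5 / 4 + μ / 2) (by simp; linarith)
  have ng := hG (3 / 2 + μ) (by simp; linarith)
  have nb := hG (1 - (1 / 4 + μ / 2)) (by simp; linarith)
  have hrefl := Gamma_reflection nc nb
  have hhalf := hyp_half (μ := -μ) (by simp; linarith) (fun h => by
    have := congrArg Complex.re h
    simp at this; linarith)
  have d1 := Gamma_duplication μ
  have d2 := Gamma_duplication (1 / 2 + μ)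
  have hg1 : Complex.Gamma (1 + μ) = μ * Complex.Gamma μ := by
    rw [add_comm]; exact Complex.Gamma_add_one μ h0
  have n32 : (3 / 2 + μ : ℂ) ≠ 0 := fun h => by
    have := congrArg Complex.re h
    simp at this; linarith
  have hg2 : Complex.Gamma (1 / 2 + μ + 2) = (3 / 2 + μ) * Complex.Gamma (3 / 2 + μ) := by
    rw [← Complex.Gamma_add_one _ n32]; congr 1; ring
  rw [coeffB, exp_add_exp_neg, hg2]
  rw [show (Real.pi / 2 * (1 / 2 + μ - 1) : ℂ) = Real.pi * (1 / 4 + μ / 2) - Real.pi / 2 by ring,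
    Complex.cos_sub_pi_div_two, show (1 / 2 + μ + 1) / 2 = (1 + (1 / 2 + μ)) / 2 by ring,
    show 1 / 2 + μ - 1 / 2 = μ by ring, show 1 - (1 / 2 + μ) / 2 = 1 - (1 / 4 + μ / 2) by ring]
  rw [show 1 + (1 / 2 + μ) / 2 = 5 / 4 + μ / 2 by ring, show 1 + (1 / 2 + μ) = 3 / 2 + μ by ring]
    at d2
  rw [show 1 / 4 - -μ / 2 = 1 / 4 + μ / 2 by ring, show 5 / 4 - -μ / 2 = 5 / 4 + μ / 2 by ring,
    show (1 - -μ) / 2 = (1 + μ) / 2 by ring, show 1 - -μ / 2 = 1 + μ / 2 by ring, d1, hg1] at hhalf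
  rw [show 1 + (1 / 2 + μ) = 3 / 2 + μ by ring]
  have hpi : (Real.pi : ℂ) ≠ 0 := by exact_mod_cast Real.pi_ne_zero
  have p1 : (2 : ℂ) ^ (1 / 2 + μ - 2) * 2 ^ (-(1 / 2 + μ)) = 1 / 4 := by
    rw [← Complex.cpow_add _ _ two_ne_zero, show 1 / 2 + μ - 2 + -(1 / 2 + μ) = -2 by ring,
      Complex.cpow_neg]
    norm_num
  have p2 : (2 : ℂ) ^ μ * 2 ^ (-μ) = 1 := by
    rw [← Complex.cpow_add _ _ two_ne_zero, add_neg_cancel, Complex.cpow_zero]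
  have e1 : hyp (-μ) (1 / 2) = μ * Complex.Gamma μ * 2 ^ (-μ) * (√Real.pi : ℝ) /
      (Complex.Gamma (1 / 4 + μ / 2) * Complex.Gamma (5 / 4 + μ / 2)) := by
    rw [eq_div_iff (mul_ne_zero nc ne), ← hhalf]; ring
  have e2 : Complex.Gamma ((3 / 2 + μ) / 2) = Complex.Gamma (3 / 2 + μ) * 2 ^ (-(1 / 2 + μ)) *
      (√Real.pi : ℝ) / Complex.Gamma (5 / 4 + μ / 2) := by
    rw [eq_div_iff ne, d2]
  have e3 : Complex.sin (Real.pi * (1 / 4 + μ / 2)) = Real.pi /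
      (Complex.Gamma (1 / 4 + μ / 2) * Complex.Gamma (1 - (1 / 4 + μ / 2))) := by
    rw [eq_div_iff (mul_ne_zero nc nb), mul_comm]; exact hrefl
  rw [e1, e2, e3]
  generalize Complex.Gamma (1 / 4 + μ / 2) = c at nc ⊢
  generalize Complex.Gamma (5 / 4 + μ / 2) = e at ne ⊢
  generalize Complex.Gamma (3 / 2 + μ) = g at ng ⊢
  generalize Complex.Gamma (1 - (1 / 4 + μ / 2)) = b at nb ⊢
  generalize (3 / 2 + μ) = w at n32 ⊢
  generalize Complex.Gamma μ = m
  generalize ((√Real.pi : ℝ) : ℂ) = q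
  generalize (2 : ℂ) ^ μ = v1 at p2 ⊢
  generalize (2 : ℂ) ^ (-μ) = v2 at p2 ⊢
  generalize (2 : ℂ) ^ (1 / 2 + μ - 2) = v3 at p1 ⊢
  generalize (2 : ℂ) ^ (-(1 / 2 + μ)) = v4 at p1 ⊢
  field_simp
  linear_combination (4 * m * q) * p1 - (m * q) * p2

theorem coeffD_eq {μ : ℂ} (h1 : -(1 / 2) < μ.re) (h2 : μ.re ≤ 1 / 2) (h0 : μ ≠ 0) :
    coeffD (1 / 2 + μ) * (3 / 2 - μ) = -((1 / 2) ^ μ * hyp μ (1 / 2) / (2 * μ)) := by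
  rw [coeffD, exp_add_exp_neg]
  -- At s = 1 `hyp_half` is not available, but both sides vanish: the left through cos(π/2), the
  -- right through `hyp_half_of_eq`.
  by_cases hμ : μ = 1 / 2
  · subst hμ
    rw [hyp_half_of_eq, show (Real.pi / 2 * (-(1 / 2 + 1 / 2)) : ℂ) = -(Real.pi / 2) by ring,
      Complex.cos_neg, Complex.cos_pi_div_two]
    simp
  have hG : ∀ w : ℂ, 0 < w.re → Complex.Gamma w ≠ 0 := fun w hw => Complex.Gamma_ne_zero_of_re_pos hw
  have ne := hG (5 / 4 - μ / 2) (by simp; linarith)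
  have ng := hG (3 / 2 - μ) (by simp; linarith)
  have nb := hG (3 / 4 + μ / 2) (by simp; linarith)
  have n4 : (1 / 4 - μ / 2 : ℂ) ≠ 0 := fun h => hμ (by linear_combination -2 * h)
  have nc : Complex.Gamma (1 / 4 - μ / 2) ≠ 0 := by
    refine Complex.Gamma_ne_zero fun m h => n4 ?_
    have h3 := congrArg Complex.re h
    simp at h3
    have : m = 0 := by
      by_contra hm
      have : (1 : ℝ) ≤ m := by exact_mod_cast Nat.one_le_iff_ne_zero.2 hm
      linarith
    rw [h, this]; simp
  have hrefl := Gamma_reflection (w := 1 / 4 - μ / 2) nc (by convert nb using 2; ring)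
  have hhalf := hyp_half h2 hμ
  have d1 := Gamma_duplication (-μ)
  have d2 := Gamma_duplication (1 / 2 - μ)
  have hg1 : Complex.Gamma (1 + -μ) = -μ * Complex.Gamma (-μ) := by
    rw [add_comm]; exact Complex.Gamma_add_one (-μ) (neg_ne_zero.2 h0)
  have n32 : (3 / 2 - μ : ℂ) ≠ 0 := fun h => by
    have := congrArg Complex.re h
    simp at this; linarith
  have hg2 : Complex.Gamma (3 - (1 / 2 + μ)) = (3 / 2 - μ) * Complex.Gamma (3 / 2 - μ) := by
    rw [← Complex.Gamma_add_one _ n32]; congr 1; ring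
  rw [hg2]
  rw [show (Real.pi / 2 * (-(1 / 2 + μ)) : ℂ) = Real.pi * (1 / 4 - μ / 2) - Real.pi / 2 by ring,
    Complex.cos_sub_pi_div_two, show (1 / 2 + μ + 1) / 2 = 3 / 4 + μ / 2 by ring,
    show 1 / 2 - (1 / 2 + μ) = -μ by ring]
  rw [show 1 - (1 / 4 - μ / 2) = 3 / 4 + μ / 2 by ring] at hrefl
  rw [show 1 + (1 / 2 - μ) / 2 = 5 / 4 - μ / 2 by ring, show 1 + (1 / 2 - μ) = 3 / 2 - μ by ring,
    show (3 / 2 - μ) / 2 = 1 - (1 / 2 + μ) / 2 by ring] at d2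
  rw [show (1 - μ) / 2 = (1 + -μ) / 2 by ring, show 1 - μ / 2 = 1 + -μ / 2 by ring, d1, hg1]
    at hhalf
  have hpi : (Real.pi : ℂ) ≠ 0 := by exact_mod_cast Real.pi_ne_zero
  have p1 : (2 : ℂ) ^ (1 / 2 + μ + 1) = 2 ^ (-(1 / 2 - μ)) * 4 := by
    rw [show (4 : ℂ) = 2 ^ (2 : ℂ) by norm_num, ← Complex.cpow_add _ _ two_ne_zero]
    congr 1; ring
  have p2 : (2 : ℂ) ^ (-μ) * 2 ^ (- -μ) = 1 := by
    rw [← Complex.cpow_add _ _ two_ne_zero, add_neg_cancel, Complex.cpow_zero]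
  have p3 : (2 : ℂ) ^ (-(1 / 2 - μ)) ≠ 0 := by simp [Complex.cpow_eq_zero_iff]
  have e1 : hyp μ (1 / 2) = -μ * Complex.Gamma (-μ) * 2 ^ (- -μ) * (√Real.pi : ℝ) /
      (Complex.Gamma (1 / 4 - μ / 2) * Complex.Gamma (5 / 4 - μ / 2)) := by
    rw [eq_div_iff (mul_ne_zero nc ne), ← hhalf]; ring
  have e2 : Complex.Gamma (1 - (1 / 2 + μ) / 2) = Complex.Gamma (3 / 2 - μ) *
      2 ^ (-(1 / 2 - μ)) * (√Real.pi : ℝ) / Complex.Gamma (5 / 4 - μ / 2) := by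
    rw [eq_div_iff ne, d2]
  have e3 : Complex.sin (Real.pi * (1 / 4 - μ / 2)) = Real.pi /
      (Complex.Gamma (1 / 4 - μ / 2) * Complex.Gamma (3 / 4 + μ / 2)) := by
    rw [eq_div_iff (mul_ne_zero nc nb), mul_comm]; exact hrefl
  rw [half_cpow, e1, e2, e3, p1]
  generalize Complex.Gamma (1 / 4 - μ / 2) = c at nc ⊢
  generalize Complex.Gamma (5 / 4 - μ / 2) = e at ne ⊢
  generalize Complex.Gamma (3 / 2 - μ) = g at ng ⊢
  generalize Complex.Gamma (3 / 4 + μ / 2) = b at nb ⊢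
  generalize (3 / 2 - μ) = w at n32 ⊢
  generalize Complex.Gamma (-μ) = m
  generalize ((√Real.pi : ℝ) : ℂ) = q
  generalize (2 : ℂ) ^ (- -μ) = v1 at p2 ⊢
  generalize (2 : ℂ) ^ (-μ) = v2 at p2 ⊢
  generalize (2 : ℂ) ^ (-(1 / 2 - μ)) = v4 at p3 ⊢
  field_simp
  linear_combination -(4 * m * q) * p2

/-! ### Solutions of `(1 + x²) H'' + λ H = 0` -/

/-- `f` solves `(1 + x²) f'' + λ f = 0` on the real line, with derivative `f'`. -/
def IsSol (lam : ℂ) (f f' : ℝ → ℂ) : Prop :=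
  ∀ x : ℝ, HasDerivAt f (f' x) x ∧ HasDerivAt f' (-lam / (1 + (x : ℂ) ^ 2) * f x) x

/-- The equation has no first-order term, so Wronskians are constant. -/
theorem IsSol.wronskian_eq {lam : ℂ} {f f' g g' : ℝ → ℂ} (hf : IsSol lam f f')
    (hg : IsSol lam g g') (x y : ℝ) :
    f x * g' x - g x * f' x = f y * g' y - g y * f' y := by
  have h : ∀ x, HasDerivAt (fun x => f x * g' x - g x * f' x) 0 x := fun x => by
    refine (((hf x).1.mul (hg x).2).sub ((hg x).1.mul (hf x).2)).congr_deriv ?_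
    ring
  exact is_const_of_deriv_eq_zero (fun x => (h x).differentiableAt) (fun x => (h x).deriv) x y

/-! ### The solutions with prescribed behaviour at infinity -/

/-- `√(1 + x²)`. -/
def rad (x : ℝ) : ℝ := √(1 + x ^ 2)

/-- The argument `(1 - x / √(1 + x²)) / 2` of the hypergeometric function. -/
def jostArg (x : ℝ) : ℝ := (1 - x / rad x) / 2

/-- `(x + √(1 + x²)) / 2`. -/
def jostBase (x : ℝ) : ℝ := (x + rad x) / 2

/-- The solution of `(1 + x²) f'' + (1/4 - μ²) f = 0` with `f(x) ~ x ^ (1/2 + μ)`. -/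
def jost (μ : ℂ) (x : ℝ) : ℂ :=
  (√(rad x) : ℝ) * ((jostBase x : ℂ) ^ μ * hyp μ (jostArg x))

/-- The logarithmic-derivative factor in `jostDeriv`. -/
def jostSlope (μ z : ℂ) : ℂ :=
  (1 / 2 * (1 - 2 * z) + μ) * hyp μ z - 2 * z * (1 - z) * hypDeriv μ z

/-- The derivative of `jost`. -/
def jostDeriv (μ : ℂ) (x : ℝ) : ℂ :=
  ((√(rad x))⁻¹ : ℝ) * ((jostBase x : ℂ) ^ μ * jostSlope μ (jostArg x))

theorem rad_pos (x : ℝ) : 0 < rad x := Real.sqrt_pos.2 (by positivity)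

theorem rad_sq (x : ℝ) : rad x ^ 2 = 1 + x ^ 2 := Real.sq_sqrt (by positivity)

theorem abs_lt_rad (x : ℝ) : |x| < rad x := by
  refine abs_lt_of_sq_lt_sq ?_ (rad_pos x).le
  rw [rad_sq]; linarith

theorem jostBase_pos (x : ℝ) : 0 < jostBase x := by
  have := (abs_lt.1 (abs_lt_rad x)).1
  rw [jostBase]; linarith

theorem jostArg_pos (x : ℝ) : 0 < jostArg x := by
  have h := (div_lt_one (rad_pos x)).2 (abs_lt.1 (abs_lt_rad x)).2
  rw [jostArg]; linarith

theorem jostArg_lt_one (x : ℝ) : jostArg x < 1 := by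
  have h : -1 < x / rad x := by
    rw [lt_div_iff₀ (rad_pos x)]; linarith [(abs_lt.1 (abs_lt_rad x)).1]
  rw [jostArg]; linarith

theorem norm_jostArg (x : ℝ) : ‖(jostArg x : ℂ)‖ = jostArg x := by
  rw [Complex.norm_real, Real.norm_of_nonneg (jostArg_pos x).le]

theorem norm_jostArg_lt (x : ℝ) : ‖(jostArg x : ℂ)‖ < 1 := by
  rw [norm_jostArg]; exact jostArg_lt_one x

theorem jostArg_mul (x : ℝ) : jostArg x * (1 - jostArg x) = 1 / (4 * rad x ^ 2) := by
  have h := rad_sq x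
  have h0 := (rad_pos x).ne'
  rw [jostArg]
  field_simp
  linear_combination 4 * h

theorem jostArg_eq (x : ℝ) : jostArg x = 1 / (4 * rad x * jostBase x) := by
  have h := rad_sq x
  have h0 := (rad_pos x).ne'
  have h1 := (jostBase_pos x).ne'
  rw [eq_div_iff (by positivity), jostArg, jostBase]
  field_simp
  linear_combination 4 * h

theorem hasDerivAt_rad (x : ℝ) : HasDerivAt rad (x / rad x) x := by
  have h : HasDerivAt (fun x : ℝ => 1 + x ^ 2) (2 * x) x := by
    simpa using (hasDerivAt_pow 2 x).const_add 1
  refine (h.sqrt (by positivity)).congr_deriv ?_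
  rw [← rad]; have := (rad_pos x).ne'; field_simp

theorem hasDerivAt_jostArg (x : ℝ) :
    HasDerivAt jostArg (-2 * jostArg x * (1 - jostArg x) / rad x) x := by
  have h0 := (rad_pos x).ne'
  refine ((((hasDerivAt_id x).div (hasDerivAt_rad x) h0).const_sub 1).div_const 2).congr_deriv ?_
  rw [mul_assoc, jostArg_mul]
  have h := rad_sq x
  simp only [id]
  field_simp
  linear_combination -4 * h

theorem hasDerivAt_jostBase (x : ℝ) : HasDerivAt jostBase (jostBase x / rad x) x := by
  refine (((hasDerivAt_id x).add (hasDerivAt_rad x)).div_const 2).congr_deriv ?_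
  have h0 := (rad_pos x).ne'
  rw [jostBase]; field_simp; ring

theorem hasDerivAt_jostBase_cpow (μ : ℂ) (x : ℝ) :
    HasDerivAt (fun x => (jostBase x : ℂ) ^ μ) (μ * (jostBase x : ℂ) ^ μ / rad x) x := by
  have hb : (jostBase x : ℂ) ≠ 0 := by exact_mod_cast (jostBase_pos x).ne'
  have h := ((hasDerivAt_id (jostBase x : ℂ)).cpow_const (c := μ)
    (Complex.ofReal_mem_slitPlane.2 (jostBase_pos x))).comp x (hasDerivAt_jostBase x).ofReal_comp
  refine h.congr_deriv ?_
  simp only [id, Complex.cpow_sub _ _ hb, Complex.cpow_one]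
  push_cast
  field_simp

theorem hasDerivAt_sqrt_rad (x : ℝ) :
    HasDerivAt (fun x => ((√(rad x) : ℝ) : ℂ))
      (((√(rad x))⁻¹ : ℝ) * (1 / 2 * (1 - 2 * jostArg x))) x := by
  refine ((hasDerivAt_rad x).sqrt (rad_pos x).ne').ofReal_comp.congr_deriv ?_
  have h0 : (rad x : ℂ) ≠ 0 := by exact_mod_cast (rad_pos x).ne'
  have h1 : ((√(rad x) : ℝ) : ℂ) ≠ 0 := by exact_mod_cast (Real.sqrt_pos.2 (rad_pos x)).ne'
  rw [jostArg]
  push_cast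
  field_simp
  ring

theorem hasDerivAt_inv_sqrt_rad (x : ℝ) :
    HasDerivAt (fun x => (((√(rad x))⁻¹ : ℝ) : ℂ))
      (-(((√(rad x))⁻¹ : ℝ) * (1 / 2 * (1 - 2 * jostArg x)) / rad x)) x := by
  have hs := Real.sqrt_pos.2 (rad_pos x)
  refine (((hasDerivAt_rad x).sqrt (rad_pos x).ne').inv hs.ne').ofReal_comp.congr_deriv ?_
  have h0 : (rad x : ℂ) ≠ 0 := by exact_mod_cast (rad_pos x).ne'
  have h1 : ((√(rad x) : ℝ) : ℂ) ≠ 0 := by exact_mod_cast hs.ne'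
  rw [jostArg, Real.sq_sqrt (rad_pos x).le]
  push_cast
  field_simp
  ring

theorem hasDerivAt_comp_jostArg {h : ℂ → ℂ} {h' : ℂ} {x : ℝ} (hh : HasDerivAt h h' (jostArg x)) :
    HasDerivAt (fun x => h (jostArg x))
      (h' * (-2 * jostArg x * (1 - jostArg x) / rad x)) x := by
  refine (hh.comp x (hasDerivAt_jostArg x).ofReal_comp).congr_deriv ?_
  push_cast; ring

/-- With x = sinh u one has `rad` = cosh u, `jostBase` = e^u/2 and `jostArg` = (1 − tanh u)/2. After
the factors √(cosh u) and e^(μu) are removed, the equation is the hypergeometric one in `jostArg`.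
-/
theorem isSol_jost {μ : ℂ} (hμ : μ.re ≤ 1 / 2) :
    IsSol (1 / 4 - μ ^ 2) (jost μ) (jostDeriv μ) := by
  intro x
  have h0 : (rad x : ℂ) ≠ 0 := by exact_mod_cast (rad_pos x).ne'
  have h1 : ((√(rad x) : ℝ) : ℂ) ≠ 0 := by exact_mod_cast (Real.sqrt_pos.2 (rad_pos x)).ne'
  have h2 : ((√(rad x) : ℝ) : ℂ) ^ 2 = rad x := by
    exact_mod_cast Real.sq_sqrt (rad_pos x).le
  have h3 : (rad x : ℂ) ^ 2 = 1 + (x : ℂ) ^ 2 := by exact_mod_cast rad_sq x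
  have hz := norm_jostArg_lt x
  have dP := hasDerivAt_hyp hμ hz
  obtain ⟨w, dQ, hw⟩ := exists_hasDerivAt_hypDeriv hμ hz
  constructor
  · refine ((hasDerivAt_sqrt_rad x).mul ((hasDerivAt_jostBase_cpow μ x).mul
      (hasDerivAt_comp_jostArg dP))).congr_deriv ?_
    simp only [jostDeriv, jostSlope, Pi.mul_apply]
    push_cast
    field_simp
    rw [h2]
    ring
  · have hid : HasDerivAt (fun z : ℂ => z) 1 (jostArg x : ℂ) := hasDerivAt_id _
    have dS := (((((hid.const_mul 2).const_sub 1).const_mul (1 / 2)).add_const μ).mul dP).sub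
      (((hid.const_mul 2).mul (hid.const_sub 1)).mul dQ)
    refine ((hasDerivAt_inv_sqrt_rad x).mul ((hasDerivAt_jostBase_cpow μ x).mul
      (hasDerivAt_comp_jostArg dS))).congr_deriv ?_
    have h4 : ((√(rad x) : ℝ) : ℂ) = ((√(rad x))⁻¹ : ℝ) * (rad x : ℂ) := by
      rw [← h2]; push_cast; field_simp
    simp only [jost, Pi.mul_apply, Pi.sub_apply, ← h3, h4]
    generalize (((√(rad x))⁻¹ : ℝ) : ℂ) = i
    field_simp
    linear_combination (64 * (i * (jostBase x : ℂ) ^ μ) * jostArg x * (1 - jostArg x)) * hw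

/-! ### Behaviour at infinity, Wronskian and connection formula -/

theorem jostArg_le {x : ℝ} (hx : 0 < x) : jostArg x ≤ 1 / (4 * x ^ 2) := by
  have h := (abs_lt.1 (abs_lt_rad x)).2
  rw [jostArg_eq, jostBase]
  refine one_div_le_one_div_of_le (by positivity) ?_
  nlinarith

theorem tendsto_jostArg : Filter.Tendsto jostArg Filter.atTop (nhds 0) := by
  have h : Filter.Tendsto (fun x : ℝ => 1 / (4 * x ^ 2)) Filter.atTop (nhds 0) := by
    refine Filter.Tendsto.const_div_atTop ?_ 1
    exact (Filter.tendsto_pow_atTop two_ne_zero).const_mul_atTop (by norm_num)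
  refine tendsto_of_tendsto_of_tendsto_of_le_of_le' tendsto_const_nhds h
    (Filter.Eventually.of_forall fun x => (jostArg_pos x).le) ?_
  filter_upwards [Filter.eventually_gt_atTop 0] with x hx using jostArg_le hx

theorem hyp_zero (μ : ℂ) : hyp μ 0 = 1 := by
  rw [hyp, tsum_eq_single 0 (fun n hn => by simp [hn])]
  simp [hypCoeff]

/-- The square roots and the powers of `jostBase` cancel, leaving a function of `jostArg` alone. It
is constant in x, and letting x → ∞, that is `jostArg` → 0, gives (1/2 − μ) − (1/2 + μ). -/
theorem wronskian_jost {μ : ℂ} (h1 : -(1 / 2) ≤ μ.re) (h2 : μ.re ≤ 1 / 2) (x : ℝ) :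
    jost μ x * jostDeriv (-μ) x - jost (-μ) x * jostDeriv μ x = -2 * μ := by
  have h1' : (-μ).re ≤ 1 / 2 := by simp; linarith
  have s1 := isSol_jost h2
  have s2 := isSol_jost h1'
  rw [neg_sq] at s2
  have key : ∀ y, jost μ y * jostDeriv (-μ) y - jost (-μ) y * jostDeriv μ y =
      hyp μ (jostArg y) * jostSlope (-μ) (jostArg y) -
        hyp (-μ) (jostArg y) * jostSlope μ (jostArg y) := fun y => by
    have hb : (jostBase y : ℂ) ≠ 0 := by exact_mod_cast (jostBase_pos y).ne'
    have e1 : ((√(rad y) : ℝ) : ℂ) * ((√(rad y))⁻¹ : ℝ) = 1 := by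
      exact_mod_cast mul_inv_cancel₀ (Real.sqrt_pos.2 (rad_pos y)).ne'
    have e2 : (jostBase y : ℂ) ^ μ * (jostBase y : ℂ) ^ (-μ) = 1 := by
      rw [← Complex.cpow_add _ _ hb, add_neg_cancel, Complex.cpow_zero]
    rw [jost, jost, jostDeriv, jostDeriv]
    linear_combination
      (hyp μ (jostArg y) * jostSlope (-μ) (jostArg y) -
        hyp (-μ) (jostArg y) * jostSlope μ (jostArg y)) *
      ((jostBase y : ℂ) ^ μ * (jostBase y : ℂ) ^ (-μ) * e1 + e2)
  have hz : ‖(0 : ℂ)‖ < 1 := by simp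
  have cP : ∀ ν : ℂ, ν.re ≤ 1 / 2 → ContinuousAt (hyp ν) 0 := fun ν hν =>
    (hasDerivAt_hyp hν hz).continuousAt
  have cS : ∀ ν : ℂ, ν.re ≤ 1 / 2 → ContinuousAt (jostSlope ν) 0 := fun ν hν => by
    obtain ⟨w, hw, -⟩ := exists_hasDerivAt_hypDeriv hν hz
    have := cP ν hν
    have := hw.continuousAt
    unfold jostSlope
    fun_prop
  have hc : ContinuousAt (fun z => hyp μ z * jostSlope (-μ) z - hyp (-μ) z * jostSlope μ z) 0 :=
    ((cP μ h2).mul (cS _ h1')).sub ((cP _ h1').mul (cS μ h2))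
  have hz0 : Filter.Tendsto (fun y : ℝ => (jostArg y : ℂ)) Filter.atTop (nhds 0) := by
    simpa [Function.comp_def] using (Complex.continuous_ofReal.tendsto 0).comp tendsto_jostArg
  have hlim := hc.tendsto.comp hz0
  have hconst : ∀ y, hyp μ (jostArg y) * jostSlope (-μ) (jostArg y) -
      hyp (-μ) (jostArg y) * jostSlope μ (jostArg y) =
      jost μ x * jostDeriv (-μ) x - jost (-μ) x * jostDeriv μ x := fun y => by
    rw [← key, s1.wronskian_eq s2 x y]
  have := tendsto_nhds_unique hlim (tendsto_const_nhds.congr fun y => (hconst y).symm)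
  rw [← this]
  simp [jostSlope, hyp_zero]
  ring

/-- The connection formula for the solution with `H(0) = 0`, `H'(0) = 1`. -/
theorem IsSol.eq_jost {μ : ℂ} (h1 : -(1 / 2) ≤ μ.re) (h2 : μ.re ≤ 1 / 2) {H F : ℝ → ℂ}
    (hH : IsSol (1 / 4 - μ ^ 2) H F) (H0 : H 0 = 0) (F0 : F 0 = 1) (x : ℝ) :
    2 * μ * H x = jost (-μ) 0 * jost μ x - jost μ 0 * jost (-μ) x := by
  have h1' : (-μ).re ≤ 1 / 2 := by simp; linarith
  have s2 := isSol_jost h1'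
  rw [neg_sq] at s2
  -- The initial values of H make its Wronskian with a solution g equal to −g(0). Eliminating H'
  -- from the two Wronskians is Cramer's rule.
  have w1 := hH.wronskian_eq (isSol_jost h2) x 0
  have w2 := hH.wronskian_eq s2 x 0
  have w := wronskian_jost h1 h2 x
  rw [H0, F0] at w1 w2
  linear_combination H x * w + jost (-μ) x * w1 - jost μ x * w2

theorem rad_zero : rad 0 = 1 := by simp [rad]

theorem jost_zero (μ : ℂ) : jost μ 0 = (1 / 2) ^ μ * hyp μ (1 / 2) := by
  simp [jost, jostBase, jostArg, rad_zero]

/-! ### The Huber transform of `f⁺` -/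

theorem IsSol.continuous {lam : ℂ} {f f' : ℝ → ℂ} (h : IsSol lam f f') : Continuous f :=
  continuous_iff_continuousAt.2 fun x => (h x).1.continuousAt

theorem hasDerivAt_integral {f : ℝ → ℂ} (hf : Continuous f) (x : ℝ) :
    HasDerivAt (fun x => ∫ y in (0 : ℝ)..x, f y) (f x) x :=
  (hf.integral_hasStrictDerivAt 0 x).hasDerivAt

/-- In x = tan v the weight 1/cos² v cancels the Jacobian: η(arctan x) has derivative −λ·ξ, so η +
λH is constant, hence zero. One integration of the original equation thus gives an equation for H.
-/
theorem exists_isSol_xi (lam : ℂ) : ∃ H : ℝ → ℂ,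
    IsSol lam H (fun x => xi lam (Real.arctan x)) ∧ H 0 = 0 ∧ xi lam (Real.arctan 0) = 1 := by
  obtain ⟨η, hη, h1, h0⟩ := Classical.choose_spec (exists_isXi lam)
  have hF : ∀ x : ℝ, HasDerivAt (fun x => xi lam (Real.arctan x))
      (η (Real.arctan x) / (1 + (x : ℂ) ^ 2)) x := fun x => by
    refine ((hη _ (Real.arctan_mem_Ioo x)).1.scomp x (Real.hasDerivAt_arctan x)).congr_deriv ?_
    rw [Complex.real_smul]; push_cast; ring
  have hE : ∀ x : ℝ, HasDerivAt (fun x => η (Real.arctan x))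
      (-lam * xi lam (Real.arctan x)) x := fun x => by
    refine ((hη _ (Real.arctan_mem_Ioo x)).2.scomp x (Real.hasDerivAt_arctan x)).congr_deriv ?_
    have hc : (Real.cos (Real.arctan x) : ℂ) ^ 2 = 1 / (1 + (x : ℂ) ^ 2) := by
      exact_mod_cast congrArg (fun r : ℝ => (r : ℂ)) (Real.cos_sq_arctan x)
    have := one_add_sq_ne_zero x
    rw [Complex.real_smul, hc]
    push_cast
    field_simp
    rfl
  have hFc : Continuous fun x => xi lam (Real.arctan x) :=
    continuous_iff_continuousAt.2 fun x => (hF x).continuousAt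
  refine ⟨fun x => ∫ y in (0 : ℝ)..x, xi lam (Real.arctan y), fun x => ?_, by simp,
    by rw [Real.arctan_zero]; exact h1⟩
  refine ⟨hasDerivAt_integral hFc x, (hF x).congr_deriv ?_⟩
  have hd : ∀ x, HasDerivAt (fun x => η (Real.arctan x) +
      lam * ∫ y in (0 : ℝ)..x, xi lam (Real.arctan y)) 0 x := fun x => by
    refine ((hE x).add ((hasDerivAt_integral hFc x).const_mul lam)).congr_deriv ?_
    ring
  have hc := is_const_of_deriv_eq_zero (fun x => (hd x).differentiableAt)
    (fun x => (hd x).deriv) x 0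
  simp only [Real.arctan_zero, h0, intervalIntegral.integral_same, mul_zero, add_zero] at hc
  linear_combination (1 / (1 + (x : ℂ) ^ 2)) * hc

theorem sqrt_one_div_cos_sq_sub_one {v : ℝ} (h0 : 0 ≤ v) (h1 : v < Real.pi / 2) :
    √(1 / Real.cos v ^ 2 - 1) = Real.tan v := by
  have hc : Real.cos v ≠ 0 := (Real.cos_pos_of_mem_Ioo ⟨by linarith [Real.pi_pos], h1⟩).ne'
  have ht := Real.tan_nonneg_of_nonneg_of_le_pi_div_two h0 h1.le
  rw [← Real.inv_one_add_tan_sq hc, one_div, inv_inv, add_sub_cancel_left, Real.sqrt_sq ht]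

theorem huberTransform_fPlus {t : ℂ} {H : ℝ → ℂ}
    (hH : IsSol (1 / 4 + t ^ 2) H (fun x => xi (1 / 4 + t ^ 2) (Real.arctan x))) (H0 : H 0 = 0)
    {X Y : ℝ} (hY : 0 < Y) :
    huberTransform (fPlus X Y) t =
      (Y : ℂ)⁻¹ * ∫ x in √(X ^ 2 - 1)..(√(X ^ 2 - 1) + Y), H x := by
  set U := √(X ^ 2 - 1) with hU
  set lam := 1 / 4 + t ^ 2 with hlam
  have hU0 : 0 ≤ U := Real.sqrt_nonneg _
  have hYc : (Y : ℂ) ≠ 0 := by exact_mod_cast hY.ne'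
  set K : ℝ → ℂ := fun x => ∫ y in (0 : ℝ)..x, H y with hK
  have dK : ∀ x, HasDerivAt K (H x) x := hasDerivAt_integral hH.continuous
  have hKi : ∫ x in U..(U + Y), H x = K (U + Y) - K U :=
    intervalIntegral.integral_eq_sub_of_hasDerivAt (fun x _ => dK x)
      (hH.continuous.intervalIntegrable _ _)
  have hUV : U ≤ U + Y := by linarith
  have ha0 : 0 ≤ Real.arctan U := Real.arctan_nonneg.2 hU0
  have hab : Real.arctan U ≤ Real.arctan (U + Y) := Real.arctan_strictMono.monotone hUV
  have hb : Real.arctan (U + Y) < Real.pi / 2 := Real.arctan_lt_pi_div_two _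
  have hcos : ∀ v ∈ Icc 0 (Real.arctan (U + Y)), Real.cos v ≠ 0 := fun v hv =>
    (Real.cos_pos_of_mem_Ioo ⟨by linarith [hv.1, Real.pi_pos], hv.2.trans_lt hb⟩).ne'
  have hval : ∀ v, 0 ≤ v → v < Real.pi / 2 → fPlus X Y (1 / Real.cos v ^ 2) =
      ramp U (U + Y) (Real.tan v) := fun v h0 h1 => by
    rw [fPlus, sqrt_one_div_cos_sq_sub_one h0 h1]
  have hxi : ∀ v ∈ Icc 0 (Real.arctan (U + Y)), xi lam (Real.arctan (Real.tan v)) = xi lam v :=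
    fun v hv => by
      rw [Real.arctan_tan (by linarith [hv.1, Real.pi_pos]) (hv.2.trans_lt hb)]
  have htan : ∀ v ∈ Icc 0 (Real.arctan (U + Y)), HasDerivAt Real.tan (1 / Real.cos v ^ 2) v :=
    fun v hv => Real.hasDerivAt_tan (hcos v hv)
  have htle : ∀ {v w : ℝ}, 0 ≤ v → v < Real.pi / 2 → (Real.tan v ≤ w ↔ v ≤ Real.arctan w) := by
    intro v w h0 h1
    conv_lhs => rw [← Real.tan_arctan w]
    exact Real.strictMonoOn_tan.le_iff_le ⟨by linarith [Real.pi_pos], h1⟩ (Real.arctan_mem_Ioo w)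
  set g : ℝ → ℂ := fun v => (fPlus X Y (1 / Real.cos v ^ 2) : ℂ) *
    (xi lam v / (Real.cos v : ℂ) ^ 2) with hg
  have hxic : ContinuousOn (xi lam) (Icc 0 (Real.arctan (U + Y))) := by
    obtain ⟨η, hη, -⟩ := Classical.choose_spec (exists_isXi lam)
    exact fun v hv => (hη v ⟨by linarith [hv.1, Real.pi_pos],
      hv.2.trans_lt hb⟩).1.continuousAt.continuousWithinAt
  have htanc : ContinuousOn Real.tan (Icc 0 (Real.arctan (U + Y))) :=
    fun v hv => (htan v hv).continuousAt.continuousWithinAt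
  have hquot : ContinuousOn (fun v => xi lam v / (Real.cos v : ℂ) ^ 2)
      (Icc 0 (Real.arctan (U + Y))) :=
    hxic.div (by fun_prop) fun v hv => pow_ne_zero _ (by exact_mod_cast hcos v hv)
  have I1 : EqOn g (fun v => xi lam v / (Real.cos v : ℂ) ^ 2) (Icc 0 (Real.arctan U)) := by
    intro v hv
    have h1 : v < Real.pi / 2 := (hv.2.trans hab).trans_lt hb
    simp only [hg]
    rw [hval v hv.1 h1, ramp, if_pos ((htle hv.1 h1).2 hv.2)]
    simp
  have I2 : EqOn g (fun v => (((U + Y - Real.tan v) / Y : ℝ) : ℂ) *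
      (xi lam v / (Real.cos v : ℂ) ^ 2)) (Icc (Real.arctan U) (Real.arctan (U + Y))) := by
    intro v hv
    have h0 := ha0.trans hv.1
    have h1 : v < Real.pi / 2 := hv.2.trans_lt hb
    simp only [hg]
    rw [hval v h0 h1]
    congr 2
    rw [ramp]
    split_ifs with c1 c2
    · have : Real.tan v = U := by
        refine le_antisymm c1 (not_lt.1 fun hlt => ?_)
        have h3 : v < Real.arctan U := by
          rw [← Real.arctan_tan (by linarith [Real.pi_pos]) h1]
          exact Real.arctan_strictMono hlt
        exact absurd hv.1 (not_le.2 h3)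
      rw [this, add_sub_cancel_left, div_self hY.ne']
    · rw [add_sub_cancel_left]
    · exact absurd ((htle h0 h1).2 hv.2) c2
  have I3 : EqOn g (fun _ => 0) (uIcc (Real.arctan (U + Y)) (Real.pi / 2)) := by
    intro v hv
    rw [uIcc_of_le hb.le] at hv
    simp only [hg]
    -- At v = π/2 the cosine is 0 and division by zero returns 0, so the integrand vanishes there as
    -- well.
    rcases hv.2.eq_or_lt with rfl | h1
    · simp
    have h0 := (ha0.trans hab).trans hv.1
    rw [hval v h0 h1, ramp]
    split_ifs with c1 c2
    · have := ((htle h0 h1).1 c1).trans hab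
      have h4 : Real.arctan (U + Y) ≤ Real.arctan U := hv.1.trans ((htle h0 h1).1 c1)
      exact absurd h4 (not_le.2 (Real.arctan_strictMono (by linarith)))
    · have h4 : v = Real.arctan (U + Y) := le_antisymm ((htle h0 h1).1 c2) hv.1
      rw [h4, Real.tan_arctan, sub_self]; simp
    · simp
  have sub1 : Icc 0 (Real.arctan U) ⊆ Icc 0 (Real.arctan (U + Y)) := Icc_subset_Icc_right hab
  have sub2 : Icc (Real.arctan U) (Real.arctan (U + Y)) ⊆ Icc 0 (Real.arctan (U + Y)) :=
    Icc_subset_Icc_left ha0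
  have c1 : ContinuousOn g (uIcc 0 (Real.arctan U)) := by
    rw [uIcc_of_le ha0]; exact (hquot.mono sub1).congr I1
  have c2 : ContinuousOn g (uIcc (Real.arctan U) (Real.arctan (U + Y))) := by
    rw [uIcc_of_le hab]
    refine ContinuousOn.congr ?_ I2
    exact (Complex.continuous_ofReal.comp_continuousOn
      ((continuousOn_const.sub (htanc.mono sub2)).div_const _)).mul (hquot.mono sub2)
  have c3 : ContinuousOn g (uIcc (Real.arctan (U + Y)) (Real.pi / 2)) :=
    continuousOn_const.congr I3
  have E1 : ∫ v in (0 : ℝ)..Real.arctan U, g v = H U := by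
    rw [intervalIntegral.integral_eq_sub_of_hasDerivAt (f := fun v => H (Real.tan v)) (fun v hv => ?_)
      c1.intervalIntegrable]
    · simp [Real.tan_arctan, H0]
    · rw [uIcc_of_le ha0] at hv
      refine ((hH _).1.scomp v (htan v (sub1 hv))).congr_deriv ?_
      rw [I1 hv, Complex.real_smul]
      simp only [hxi v (sub1 hv)]
      push_cast; ring
  have E2 : ∫ v in Real.arctan U..Real.arctan (U + Y), g v =
      (K (U + Y) - K U) / Y - H U := by
    -- Integration by parts on the sloping piece: the term K/Y compensates the derivative −1/Y of
    -- the cutoff. The resulting −H(U) cancels the contribution of [0, arctan U].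
    rw [intervalIntegral.integral_eq_sub_of_hasDerivAt
      (f := fun v => (((U + Y - Real.tan v) / Y : ℝ) : ℂ) * H (Real.tan v) + K (Real.tan v) / Y)
      (fun v hv => ?_) c2.intervalIntegrable]
    · simp only [Real.tan_arctan]
      push_cast; field_simp; ring
    · rw [uIcc_of_le hab] at hv
      have ht := htan v (sub2 hv)
      refine (((((ht.const_sub (U + Y)).div_const Y).ofReal_comp).mul
        ((hH _).1.scomp v ht)).add (((dK _).scomp v ht).div_const (Y : ℂ))).congr_deriv ?_
      rw [I2 hv]
      simp only [Complex.real_smul, hxi v (sub2 hv), Function.comp]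
      push_cast; ring
  have E3 : ∫ v in Real.arctan (U + Y)..(Real.pi / 2), g v = 0 := by
    rw [intervalIntegral.integral_congr I3]; simp
  rw [hKi, huberTransform, ← intervalIntegral.integral_add_adjacent_intervals
    (c1.intervalIntegrable.trans c2.intervalIntegrable) c3.intervalIntegrable,
    ← intervalIntegral.integral_add_adjacent_intervals c1.intervalIntegrable c2.intervalIntegrable,
    E1, E2, E3]
  field_simp
  ring

/-! ### Bounds for powers and for the solutions `jost` -/

theorem norm_cpow_sub_cpow_le {s : ℂ} {x y L : ℝ} (hx : 0 < x) (hy : 0 < y)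
    (hL : ∀ u ∈ uIcc x y, u ^ (s.re - 1) ≤ L) :
    ‖(y : ℂ) ^ s - (x : ℂ) ^ s‖ ≤ ‖s‖ * L * |y - x| := by
  have hpos : ∀ u ∈ uIcc x y, 0 < u := fun u hu => (lt_min hx hy).trans_le hu.1
  refine (convex_uIcc x y).norm_image_sub_le_of_norm_hasDerivWithin_le
    (f := fun u : ℝ => (u : ℂ) ^ s) (f' := fun u : ℝ => s * (u : ℂ) ^ (s - 1))
    (fun u hu => ?_) (fun u hu => ?_) left_mem_uIcc right_mem_uIcc
  · have h := ((hasDerivAt_id (u : ℂ)).cpow_const (c := s)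
      (Complex.ofReal_mem_slitPlane.2 (hpos u hu))).comp_ofReal
    simpa using h.hasDerivWithinAt
  · rw [norm_mul, Complex.norm_cpow_eq_rpow_re_of_pos (hpos u hu)]
    gcongr
    simpa using hL u hu

theorem norm_cpow_sub_cpow_le_of_le {s : ℂ} {m x y : ℝ} (hs : s.re ≤ 1) (hm : 0 < m) (hx : m ≤ x)
    (hy : m ≤ y) : ‖(y : ℂ) ^ s - (x : ℂ) ^ s‖ ≤ ‖s‖ * m ^ (s.re - 1) * |y - x| :=
  norm_cpow_sub_cpow_le (hm.trans_le hx) (hm.trans_le hy) fun _ hu =>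
    Real.rpow_le_rpow_of_nonpos hm ((le_min hx hy).trans hu.1) (by linarith)

theorem rad_sub_le {x : ℝ} (hx : 0 < x) : rad x - x ≤ 1 / (2 * x) := by
  have h := rad_sq x
  have h1 := (abs_lt.1 (abs_lt_rad x)).2
  rw [le_div_iff₀ (by positivity)]
  nlinarith

theorem rad_le {x : ℝ} (hx : 1 ≤ x) : rad x ≤ 2 * x := by
  have h := rad_sub_le (by linarith : 0 < x)
  have : 1 / (2 * x) ≤ 1 := by rw [div_le_one (by linarith)]; linarith
  linarith

theorem jostArg_le_half {x : ℝ} (hx : 0 ≤ x) : jostArg x ≤ 1 / 2 := by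
  have := div_nonneg hx (rad_pos x).le
  rw [jostArg]; linarith

theorem norm_jostArg_le {x : ℝ} (hx : 0 ≤ x) : ‖(jostArg x : ℂ)‖ ≤ 1 / 2 := by
  rw [norm_jostArg]; exact jostArg_le_half hx

theorem cpow_half_add {x : ℝ} (hx : 0 < x) (μ : ℂ) :
    (x : ℂ) ^ (1 / 2 + μ) = (√x : ℝ) * (x : ℂ) ^ μ := by
  rw [Complex.cpow_add _ _ (by exact_mod_cast hx.ne'), Real.sqrt_eq_rpow,
    Complex.ofReal_cpow hx.le]
  norm_num

/-- Three replacements, each of relative size O(x⁻²): `hyp` by 1, √(rad x) by √x, and `jostBase x`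
by x. Only the last costs a factor ‖μ‖. -/
theorem norm_jost_sub_le {μ : ℂ} (h2 : μ.re ≤ 1 / 2) {x : ℝ} (hx : 1 ≤ x) :
    ‖jost μ x - (x : ℂ) ^ (1 / 2 + μ)‖ ≤ 4 * (1 + ‖μ‖) * x ^ (μ.re - 3 / 2) := by
  have hx0 : 0 < x := by linarith
  have hr := rad_pos x
  have hxr := (abs_lt.1 (abs_lt_rad x)).2
  have hsx := Real.sqrt_pos.2 hx0
  have hsr := Real.sqrt_pos.2 hr
  have hsub := rad_sub_le hx0
  have hrx := rad_le hx
  have hy : x ≤ jostBase x := by rw [jostBase]; linarith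
  have hy2 : jostBase x ≤ 2 * x := by rw [jostBase]; linarith
  have hy0 := hx0.trans_le hy
  have hxσ := Real.rpow_pos_of_pos hx0 μ.re
  set p := √x * x ^ μ.re / x ^ 2 with hp
  have hp0 : 0 ≤ p := by positivity
  have hpow : x ^ (μ.re - 3 / 2) = p := by
    rw [hp, show μ.re - 3 / 2 = 1 / 2 + μ.re - 2 by ring, Real.rpow_sub hx0, Real.rpow_add hx0,
      ← Real.sqrt_eq_rpow]
    norm_num
  have hyμ : ‖(jostBase x : ℂ) ^ μ‖ ≤ 2 * x ^ μ.re := by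
    rw [Complex.norm_cpow_eq_rpow_re_of_pos hy0]
    rcases le_total 0 μ.re with h | h
    · calc jostBase x ^ μ.re ≤ (2 * x) ^ μ.re := by gcongr
        _ = 2 ^ μ.re * x ^ μ.re := Real.mul_rpow (by norm_num) hx0.le
        _ ≤ 2 ^ (1 : ℝ) * x ^ μ.re := by gcongr <;> linarith
        _ = _ := by rw [Real.rpow_one]
    · calc jostBase x ^ μ.re ≤ x ^ μ.re := Real.rpow_le_rpow_of_nonpos hx0 hy h
        _ ≤ _ := by linarith
  have hsq : √(rad x) ≤ 2 * √x := by
    rw [show 2 * √x = √(4 * x) by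
      rw [Real.sqrt_mul (by norm_num), show (4 : ℝ) = 2 ^ 2 by norm_num,
        Real.sqrt_sq (by norm_num)]]
    exact Real.sqrt_le_sqrt (by linarith)
  have b1 : ‖((√(rad x) : ℝ) : ℂ) * ((jostBase x : ℂ) ^ μ * (hyp μ (jostArg x) - 1))‖ ≤ 3 * p := by
    rw [norm_mul, norm_mul, Complex.norm_real, Real.norm_of_nonneg hsr.le]
    have h3 := norm_hyp_sub_one_le' h2 (norm_jostArg_le hx0.le)
    have h4 := jostArg_le hx0
    rw [norm_jostArg] at h3
    calc _ ≤ 2 * √x * (2 * x ^ μ.re * (3 * (1 / (4 * x ^ 2)))) := by gcongr; linarith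
      _ = _ := by rw [hp]; field_simp; norm_num
  have b2 : ‖((√(rad x) - √x : ℝ) : ℂ) * (jostBase x : ℂ) ^ μ‖ ≤ p := by
    rw [norm_mul, Complex.norm_real, Real.norm_of_nonneg
      (sub_nonneg.2 (Real.sqrt_le_sqrt hxr.le))]
    have h5 : √(rad x) - √x ≤ √x / (2 * x ^ 2) := by
      have e1 := Real.sq_sqrt hx0.le
      have e2 := Real.sq_sqrt hr.le
      have h6 : (√(rad x) - √x) * √x ≤ 1 / (2 * x) := by
        refine le_trans ?_ hsub
        have := Real.sqrt_le_sqrt hxr.le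
        nlinarith
      have h7 : √x / (2 * x ^ 2) * √x = 1 / (2 * x) := by
        rw [div_mul_eq_mul_div, ← sq, e1]; field_simp
      exact le_of_mul_le_mul_right (h6.trans_eq h7.symm) hsx
    calc _ ≤ √x / (2 * x ^ 2) * (2 * x ^ μ.re) := by gcongr
      _ = _ := by rw [hp]; field_simp
  have b3 : ‖((√x : ℝ) : ℂ) * ((jostBase x : ℂ) ^ μ - (x : ℂ) ^ μ)‖ ≤ ‖μ‖ * p := by
    rw [norm_mul, Complex.norm_real, Real.norm_of_nonneg hsx.le]
    have h3 := norm_cpow_sub_cpow_le_of_le (s := μ) (by linarith) hx0 le_rfl hy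
    have h4 : |jostBase x - x| ≤ 1 / x := by
      have : 1 / (2 * x) ≤ 1 / x := by gcongr; linarith
      rw [abs_of_nonneg (by linarith), jostBase]; linarith
    rw [Real.rpow_sub_one hx0.ne'] at h3
    calc _ ≤ √x * (‖μ‖ * (x ^ μ.re / x) * (1 / x)) := by
          gcongr; exact h3.trans (by gcongr)
      _ = _ := by rw [hp]; field_simp
  have hdec : jost μ x - (x : ℂ) ^ (1 / 2 + μ) =
      ((√(rad x) : ℝ) : ℂ) * ((jostBase x : ℂ) ^ μ * (hyp μ (jostArg x) - 1)) +
      ((√(rad x) - √x : ℝ) : ℂ) * (jostBase x : ℂ) ^ μ +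
      ((√x : ℝ) : ℂ) * ((jostBase x : ℂ) ^ μ - (x : ℂ) ^ μ) := by
    rw [cpow_half_add hx0, jost]
    push_cast; ring
  rw [hdec, hpow]
  refine (norm_add₃_le.trans (add_le_add (add_le_add b1 b2) b3)).trans ?_
  nlinarith [norm_nonneg μ]

theorem norm_jost_zero_le {μ : ℂ} (h1 : -(1 / 2) ≤ μ.re) (h2 : μ.re ≤ 1 / 2) :
    ‖jost μ 0‖ ≤ 6 := by
  rw [jost_zero, norm_mul]
  have h3 : ‖(1 / 2 : ℂ) ^ μ‖ ≤ 2 := by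
    rw [show (1 / 2 : ℂ) = ((1 / 2 : ℝ) : ℂ) by norm_num,
      Complex.norm_cpow_eq_rpow_re_of_pos (by norm_num)]
    calc (1 / 2 : ℝ) ^ μ.re ≤ (1 / 2 : ℝ) ^ (-1 : ℝ) :=
          Real.rpow_le_rpow_of_exponent_ge (by norm_num) (by norm_num) (by linarith)
      _ = 2 := by norm_num [Real.rpow_neg_one]
  have h4 := norm_hyp_le h2 (z := 1 / 2) (by norm_num)
  calc _ ≤ (2 : ℝ) * 3 := by gcongr
    _ = 6 := by norm_num

theorem norm_jost_le {μ : ℂ} (h : μ.re = 0) {x : ℝ} (hx : 0 ≤ x) :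
    ‖jost μ x‖ ≤ 3 * √(rad x) := by
  have h4 := norm_hyp_le (by linarith) (norm_jostArg_le hx) (μ := μ)
  rw [jost, norm_mul, norm_mul, Complex.norm_real, Real.norm_of_nonneg (Real.sqrt_nonneg _),
    Complex.norm_cpow_eq_rpow_re_of_pos (jostBase_pos x), h, Real.rpow_zero, one_mul, mul_comm]
  gcongr

theorem norm_jostDeriv_le {μ : ℂ} (h : μ.re = 0) {x : ℝ} (hx : 0 ≤ x) :
    ‖jostDeriv μ x‖ ≤ 5 * (1 + ‖μ‖) * (√(rad x))⁻¹ := by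
  have h4 := norm_hyp_le (by linarith) (norm_jostArg_le hx) (μ := μ)
  have h5 := norm_hypDeriv_le (by linarith) (norm_jostArg_le hx) (μ := μ)
  have hz := jostArg_le_half hx
  have hz0 := jostArg_pos x
  have e1 : ‖(1 / 2 * (1 - 2 * jostArg x) : ℂ)‖ ≤ 1 / 2 := by
    rw [show (1 / 2 * (1 - 2 * jostArg x) : ℂ) = ((1 / 2 * (1 - 2 * jostArg x) : ℝ) : ℂ) by
      push_cast; ring, Complex.norm_real, Real.norm_of_nonneg (by linarith)]
    linarith
  have e2 : ‖(2 * jostArg x * (1 - jostArg x) : ℂ)‖ ≤ 1 / 2 := by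
    rw [show (2 * jostArg x * (1 - jostArg x) : ℂ) = ((2 * jostArg x * (1 - jostArg x) : ℝ) : ℂ) by
      push_cast; ring, Complex.norm_real, Real.norm_of_nonneg (by nlinarith)]
    nlinarith [sq_nonneg (1 - 2 * jostArg x)]
  have h6 : ‖jostSlope μ (jostArg x)‖ ≤ 5 * (1 + ‖μ‖) := by
    rw [jostSlope]
    refine (norm_sub_le _ _).trans ?_
    rw [norm_mul, norm_mul]
    have e3 := (norm_add_le (1 / 2 * (1 - 2 * jostArg x) : ℂ) μ).trans (add_le_add_left e1 _)
    calc _ ≤ (1 / 2 + ‖μ‖) * 3 + 1 / 2 * 6 := by gcongr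
      _ ≤ _ := by linarith [norm_nonneg μ]
  rw [jostDeriv, norm_mul, norm_mul, Complex.norm_real,
    Real.norm_of_nonneg (inv_nonneg.2 (Real.sqrt_nonneg _)),
    Complex.norm_cpow_eq_rpow_re_of_pos (jostBase_pos x), h, Real.rpow_zero, one_mul, mul_comm]
  gcongr

/-! ### Mean values over `[U, V]` -/

/-- The mean value of `f` over `[U, U + Y]`, where `U = √(X² - 1)`. -/
def mean (X Y : ℝ) (f : ℝ → ℂ) : ℂ :=
  (Y : ℂ)⁻¹ * ∫ x in √(X ^ 2 - 1)..(√(X ^ 2 - 1) + Y), f x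

theorem norm_mean_le {X Y M : ℝ} (hY : 0 < Y) {f : ℝ → ℂ}
    (h : ∀ x ∈ Icc √(X ^ 2 - 1) (√(X ^ 2 - 1) + Y), ‖f x‖ ≤ M) : ‖mean X Y f‖ ≤ M := by
  have hle : √(X ^ 2 - 1) ≤ √(X ^ 2 - 1) + Y := by linarith
  have h1 := intervalIntegral.norm_integral_le_of_norm_le_const (a := √(X ^ 2 - 1))
    (b := √(X ^ 2 - 1) + Y) (f := f) (C := M)
    (fun x hx => h x (Ioc_subset_Icc_self (by rwa [uIoc_of_le hle] at hx)))
  rw [add_sub_cancel_left, abs_of_pos hY] at h1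
  rw [mean, norm_mul, norm_inv, Complex.norm_real, Real.norm_of_nonneg hY.le, inv_mul_le_iff₀ hY]
  linarith

theorem mean_sub {X Y : ℝ} {f g : ℝ → ℂ} (hf : Continuous f)
    (hg : IntervalIntegrable g MeasureTheory.volume √(X ^ 2 - 1) (√(X ^ 2 - 1) + Y)) :
    mean X Y (fun x => f x - g x) = mean X Y f - mean X Y g := by
  rw [mean, mean, mean, intervalIntegral.integral_sub (hf.intervalIntegrable _ _) hg, mul_sub]

theorem mean_const {X Y : ℝ} (hY : 0 < Y) (c : ℂ) : mean X Y (fun _ => c) = c := by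
  have : (Y : ℂ) ≠ 0 := by exact_mod_cast hY.ne'
  rw [mean, intervalIntegral.integral_const, add_sub_cancel_left, Complex.real_smul]
  field_simp

theorem sqrt_bounds {X : ℝ} (hX : 2 ≤ X) :
    1 ≤ √(X ^ 2 - 1) ∧ X / 2 ≤ √(X ^ 2 - 1) ∧ √(X ^ 2 - 1) ≤ X ∧ X - √(X ^ 2 - 1) ≤ X⁻¹ := by
  have h1 : 1 ≤ √(X ^ 2 - 1) := Real.one_le_sqrt.2 (by nlinarith)
  have hs := Real.sq_sqrt (show 0 ≤ X ^ 2 - 1 by nlinarith)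
  have h2 : X / 2 ≤ √(X ^ 2 - 1) := Real.le_sqrt_of_sq_le (by nlinarith)
  have h3 : √(X ^ 2 - 1) ≤ X := by nlinarith
  refine ⟨h1, h2, h3, ?_⟩
  rw [← one_div, le_div_iff₀ (by linarith)]
  nlinarith

/-- The comparison point w is left free: it is X itself in part (a), and the translate x + (X − U)
in part (b). -/
theorem norm_jost_sub_cpow_le {μ : ℂ} (h1 : -(1 / 2) ≤ μ.re) (h2 : μ.re ≤ 1 / 2) {X x w : ℝ}
    (hX : 0 < X) (hx1 : 1 ≤ x) (hx : X / 2 ≤ x) (hw : X / 2 ≤ w) :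
    ‖jost μ x - (w : ℂ) ^ (1 / 2 + μ)‖ ≤
      16 * (1 + ‖μ‖) * X ^ (μ.re - 1 / 2) * (X⁻¹ + |x - w|) := by
  have b1 := norm_jost_sub_le h2 hx1
  have b2 := norm_cpow_sub_cpow_le_of_le (s := 1 / 2 + μ) (m := X / 2) (x := w) (y := x)
    (by simp; linarith) (by linarith) hw hx
  have e : (1 / 2 + μ).re - 1 = μ.re - 1 / 2 := by simp; ring
  rw [e] at b2
  have hs : ‖1 / 2 + μ‖ ≤ 1 + ‖μ‖ := (norm_add_le _ _).trans (by norm_num)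
  have hX2 : 0 < X / 2 := by linarith
  have c1 : x ^ (μ.re - 3 / 2) ≤ 4 * (X ^ (μ.re - 1 / 2) * X⁻¹) := by
    calc x ^ (μ.re - 3 / 2) ≤ (X / 2) ^ (μ.re - 3 / 2) :=
          Real.rpow_le_rpow_of_nonpos hX2 hx (by linarith)
      _ = X ^ (μ.re - 1 / 2) * X⁻¹ / 2 ^ (μ.re - 3 / 2) := by
          rw [Real.div_rpow hX.le (by norm_num), ← Real.rpow_neg_one X, ← Real.rpow_add hX]
          ring_nf
      _ ≤ X ^ (μ.re - 1 / 2) * X⁻¹ / 2 ^ (-2 : ℝ) := by gcongr <;> linarith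
      _ = _ := by rw [Real.rpow_neg (by norm_num)]; norm_num; ring
  have c2 : (X / 2) ^ (μ.re - 1 / 2) ≤ 2 * X ^ (μ.re - 1 / 2) := by
    rw [Real.div_rpow hX.le (by norm_num)]
    calc _ ≤ X ^ (μ.re - 1 / 2) / 2 ^ (-1 : ℝ) := by gcongr <;> linarith
      _ = _ := by rw [Real.rpow_neg_one]; ring
  have hd : jost μ x - (w : ℂ) ^ (1 / 2 + μ) = (jost μ x - (x : ℂ) ^ (1 / 2 + μ)) +
      ((x : ℂ) ^ (1 / 2 + μ) - (w : ℂ) ^ (1 / 2 + μ)) := by ring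
  rw [hd]
  have hpos := Real.rpow_pos_of_pos hX (μ.re - 1 / 2)
  calc _ ≤ 4 * (1 + ‖μ‖) * (4 * (X ^ (μ.re - 1 / 2) * X⁻¹)) +
        (1 + ‖μ‖) * (2 * X ^ (μ.re - 1 / 2)) * |x - w| :=
        norm_add_le_of_le (b1.trans (by gcongr)) (b2.trans (by gcongr))
    _ ≤ 4 * (1 + ‖μ‖) * (4 * (X ^ (μ.re - 1 / 2) * X⁻¹)) +
        (1 + ‖μ‖) * (16 * X ^ (μ.re - 1 / 2)) * |x - w| := by gcongr; norm_num
    _ = _ := by ring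

theorem continuous_jost {μ : ℂ} (h2 : μ.re ≤ 1 / 2) : Continuous (jost μ) :=
  (isSol_jost h2).continuous

theorem norm_mean_jost_sub_le {μ : ℂ} (h1 : -(1 / 2) ≤ μ.re) (h2 : μ.re ≤ 1 / 2) {X Y : ℝ}
    (hXY : Admissible X Y) :
    ‖mean X Y (jost μ) - (X : ℂ) ^ (1 / 2 + μ)‖ ≤
      32 * (1 + ‖μ‖) * X ^ (μ.re - 1 / 2) * (Y + X⁻¹) := by
  obtain ⟨hX, hY, -⟩ := hXY
  obtain ⟨u1, u2, u3, u4⟩ := sqrt_bounds hX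
  have hX0 : 0 < X := by linarith
  rw [← mean_const (X := X) hY ((X : ℂ) ^ (1 / 2 + μ)), ← mean_sub (continuous_jost h2)
    (continuous_const.intervalIntegrable _ _)]
  refine norm_mean_le hY fun x hx => (norm_jost_sub_cpow_le h1 h2 hX0 (u1.trans hx.1)
    (u2.trans hx.1) (by linarith)).trans ?_
  have h3 : |x - X| ≤ Y + X⁻¹ := by
    rw [abs_le]; constructor <;> linarith [hx.1, hx.2, inv_pos.2 hX0]
  calc _ ≤ 16 * (1 + ‖μ‖) * X ^ (μ.re - 1 / 2) * ((Y + X⁻¹) + (Y + X⁻¹)) := by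
        gcongr; linarith
    _ = _ := by ring

/-! ### The transform in terms of `jost` -/

/-- The coefficient of `jost μ` in the solution with `H(0) = 0`, `H'(0) = 1`. -/
def amp (μ : ℂ) : ℂ := jost (-μ) 0 / (2 * μ)

theorem norm_amp_le {μ : ℂ} (h1 : -(1 / 2) ≤ μ.re) (h2 : μ.re ≤ 1 / 2) :
    ‖amp μ‖ ≤ 3 / ‖μ‖ := by
  have h := norm_jost_zero_le (μ := -μ) (by simp; linarith) (by simp; linarith)
  rw [amp, norm_div, norm_mul]
  calc _ ≤ 6 / (‖(2 : ℂ)‖ * ‖μ‖) := by gcongr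
    _ = _ := by norm_num; rw [mul_comm, ← div_div]; ring

theorem coeffB_mul {μ : ℂ} (h1 : -(1 / 2) < μ.re) (h2 : μ.re ≤ 1 / 2) (h0 : μ ≠ 0) :
    coeffB (1 / 2 + μ) * (3 / 2 + μ) = amp μ := by
  rw [coeffB_eq h1 h2 h0, amp, jost_zero, half_cpow, neg_neg]

theorem coeffD_mul {μ : ℂ} (h1 : -(1 / 2) < μ.re) (h2 : μ.re ≤ 1 / 2) (h0 : μ ≠ 0) :
    coeffD (1 / 2 + μ) * (3 / 2 - μ) = amp (-μ) := by
  rw [coeffD_eq h1 h2 h0, amp, jost_zero, neg_neg, mul_neg, div_neg]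

theorem huberTransform_eq {t : ℂ} (h1 : -(1 / 2) ≤ (Complex.I * t).re)
    (h2 : (Complex.I * t).re ≤ 1 / 2) (h0 : t ≠ 0) {X Y : ℝ} (hXY : Admissible X Y) :
    huberTransform (fPlus X Y) t = amp (Complex.I * t) * mean X Y (jost (Complex.I * t)) +
      amp (-(Complex.I * t)) * mean X Y (jost (-(Complex.I * t))) := by
  obtain ⟨H, hH, H0, F0⟩ := exists_isSol_xi (1 / 4 + t ^ 2)
  rw [huberTransform_fPlus hH H0 hXY.2.1]
  set μ := Complex.I * t with hμ
  have hμ0 : μ ≠ 0 := mul_ne_zero Complex.I_ne_zero h0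
  have hl : 1 / 4 + t ^ 2 = 1 / 4 - μ ^ 2 := by
    rw [hμ, mul_pow, Complex.I_sq]; ring
  rw [hl] at hH F0
  have hHeq : ∀ x, H x = amp μ * jost μ x + amp (-μ) * jost (-μ) x := fun x => by
    have := hH.eq_jost h1 h2 H0 F0 x
    rw [amp, amp, neg_neg]
    field_simp
    linear_combination this
  simp only [hHeq, mean]
  rw [intervalIntegral.integral_add
    (((continuous_jost h2).const_mul _).intervalIntegrable _ _)
    (((continuous_jost (by simp [-Complex.mul_re]; linarith)).const_mul _).intervalIntegrable _ _),
    intervalIntegral.integral_const_mul, intervalIntegral.integral_const_mul]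
  ring

theorem SpectralParam.bounds {t : ℂ} (ht : SpectralParam t) :
    0 ≤ (Complex.I * t).re ∧ (Complex.I * t).re ≤ 1 / 2 ∧ t ≠ 0 := by
  have e : (Complex.I * t).re = -t.im := by simp
  rw [e]
  rcases ht with ⟨h1, h2⟩ | ⟨-, h2, h3⟩
  · exact ⟨by simp [h1], by rw [h1]; norm_num, h2⟩
  · refine ⟨by linarith, by linarith, fun h => ?_⟩
    rw [h] at h2; simp at h2

theorem norm_huberTransform_sub_le {t : ℂ} (ht : SpectralParam t) {X Y : ℝ}
    (hXY : Admissible X Y) :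
    ‖huberTransform (fPlus X Y) t
        - (coeffB (1 / 2 + Complex.I * t) * (3 / 2 + Complex.I * t)
              * (X : ℂ) ^ (1 / 2 + Complex.I * t)
            + coeffD (1 / 2 + Complex.I * t) * (3 / 2 - Complex.I * t)
              * (X : ℂ) ^ (1 / 2 - Complex.I * t))‖
      ≤ 96 * (‖coeffB (1 / 2 + Complex.I * t) * (X : ℂ) ^ (-(1 / 2) + Complex.I * t)‖
            + ‖coeffD (1 / 2 + Complex.I * t) * (X : ℂ) ^ (-(1 / 2) - Complex.I * t)‖)
          * (1 + ‖t‖ ^ 2) * (Y + X⁻¹) := by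
  obtain ⟨h1, h2, h0⟩ := ht.bounds
  have hn : ‖t‖ = ‖Complex.I * t‖ := by simp
  rw [huberTransform_eq (by linarith) h2 h0 hXY, hn]
  have h0' := mul_ne_zero Complex.I_ne_zero h0
  generalize Complex.I * t = μ at *
  have hX0 : 0 < X := by linarith [hXY.1]
  have hYX : 0 ≤ Y + X⁻¹ := by linarith [hXY.2.1, inv_pos.2 hX0]
  have m1 := norm_mean_jost_sub_le (by linarith) h2 hXY
  have m2 := norm_mean_jost_sub_le (μ := -μ) (by simp; linarith) (by simp; linarith) hXY
  have eB : ‖coeffB (1 / 2 + μ) * (X : ℂ) ^ (-(1 / 2) + μ)‖ =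
      ‖coeffB (1 / 2 + μ)‖ * X ^ (μ.re - 1 / 2) := by
    rw [norm_mul, Complex.norm_cpow_eq_rpow_re_of_pos hX0]; simp; ring_nf; simp
  have eD : ‖coeffD (1 / 2 + μ) * (X : ℂ) ^ (-(1 / 2) - μ)‖ =
      ‖coeffD (1 / 2 + μ)‖ * X ^ ((-μ).re - 1 / 2) := by
    rw [norm_mul, Complex.norm_cpow_eq_rpow_re_of_pos hX0]; simp; ring_nf; simp
  rw [eB, eD, ← coeffB_mul (by linarith) h2 h0', ← coeffD_mul (by linarith) h2 h0']
  rw [norm_neg] at m2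
  -- The factor s + 1 of the main term is absorbed into 1 + |t|² here; with the 32 of
  -- `norm_mean_jost_sub_le` this accounts for 96.
  have n1 : ‖3 / 2 + μ‖ * (1 + ‖μ‖) ≤ 3 * (1 + ‖μ‖ ^ 2) := by
    have : ‖3 / 2 + μ‖ ≤ 3 / 2 + ‖μ‖ := (norm_add_le _ _).trans (by norm_num)
    nlinarith [norm_nonneg μ, sq_nonneg (‖μ‖ - 1)]
  have n2 : ‖3 / 2 - μ‖ * (1 + ‖μ‖) ≤ 3 * (1 + ‖μ‖ ^ 2) := by
    have : ‖3 / 2 - μ‖ ≤ 3 / 2 + ‖μ‖ := (norm_sub_le _ _).trans (by norm_num)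
    nlinarith [norm_nonneg μ, sq_nonneg (‖μ‖ - 1)]
  have hd : coeffB (1 / 2 + μ) * (3 / 2 + μ) * mean X Y (jost μ) +
      coeffD (1 / 2 + μ) * (3 / 2 - μ) * mean X Y (jost (-μ)) -
      (coeffB (1 / 2 + μ) * (3 / 2 + μ) * (X : ℂ) ^ (1 / 2 + μ) +
        coeffD (1 / 2 + μ) * (3 / 2 - μ) * (X : ℂ) ^ (1 / 2 - μ)) =
      coeffB (1 / 2 + μ) * (3 / 2 + μ) * (mean X Y (jost μ) - (X : ℂ) ^ (1 / 2 + μ)) +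
      coeffD (1 / 2 + μ) * (3 / 2 - μ) *
        (mean X Y (jost (-μ)) - (X : ℂ) ^ (1 / 2 + -μ)) := by
    rw [← sub_eq_add_neg]; ring
  rw [hd]
  refine (norm_add_le _ _).trans ?_
  simp only [norm_mul]
  have p1 := Real.rpow_nonneg hX0.le (μ.re - 1 / 2)
  have p2 := Real.rpow_nonneg hX0.le ((-μ).re - 1 / 2)
  calc _ ≤ ‖coeffB (1 / 2 + μ)‖ * ‖3 / 2 + μ‖ *
          (32 * (1 + ‖μ‖) * X ^ (μ.re - 1 / 2) * (Y + X⁻¹)) +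
        ‖coeffD (1 / 2 + μ)‖ * ‖3 / 2 - μ‖ *
          (32 * (1 + ‖μ‖) * X ^ ((-μ).re - 1 / 2) * (Y + X⁻¹)) := by gcongr
    _ = 32 * ‖coeffB (1 / 2 + μ)‖ * X ^ (μ.re - 1 / 2) * (Y + X⁻¹) *
          (‖3 / 2 + μ‖ * (1 + ‖μ‖)) +
        32 * ‖coeffD (1 / 2 + μ)‖ * X ^ ((-μ).re - 1 / 2) * (Y + X⁻¹) *
          (‖3 / 2 - μ‖ * (1 + ‖μ‖)) := by ring
    _ ≤ 32 * ‖coeffB (1 / 2 + μ)‖ * X ^ (μ.re - 1 / 2) * (Y + X⁻¹) * (3 * (1 + ‖μ‖ ^ 2)) +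
        32 * ‖coeffD (1 / 2 + μ)‖ * X ^ ((-μ).re - 1 / 2) * (Y + X⁻¹) *
          (3 * (1 + ‖μ‖ ^ 2)) := by gcongr
    _ = _ := by ring

/-! ### Real parameters -/

/-- Applied to Γ(1 ± m) with m = s − 1/2, this bounds |Γ(±m)| = Γ(1 ± m)/m below by c/m. -/
theorem exists_Gamma_lower_bound :
    ∃ c : ℝ, 0 < c ∧ ∀ x ∈ Icc (1 / 2 : ℝ) (3 / 2), c ≤ Real.Gamma x := by
  have hc : ContinuousOn Real.Gamma (Icc (1 / 2 : ℝ) (3 / 2)) := fun x hx =>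
    (Real.differentiableAt_Gamma fun m hm => by
      linarith [hx.1, (Nat.cast_nonneg m : (0 : ℝ) ≤ m)]).continuousAt.continuousWithinAt
  obtain ⟨y, hy, hmin⟩ := isCompact_Icc.exists_isMinOn ⟨1, by norm_num, by norm_num⟩ hc
  exact ⟨Real.Gamma y, Real.Gamma_pos_of_pos (by linarith [hy.1]), fun x hx => hmin hx⟩

theorem exists_norm_huberTransform_sub_le_of_real :
    ∃ C : ℝ, ∀ s : ℝ, 1 / 2 < s → s ≤ 1 → ∀ t : ℂ, (s : ℂ) = 1 / 2 + Complex.I * t →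
      ∀ X Y : ℝ, Admissible X Y →
        ‖huberTransform (fPlus X Y) t
            - (coeffB s * (s + 1) * (X : ℂ) ^ (s : ℂ)
              + coeffD s * (2 - s) * (X : ℂ) ^ (1 - s : ℂ))‖
          ≤ C * (|Real.Gamma (s - 1 / 2)| * Y + |Real.Gamma (1 / 2 - s)| * X ^ (1 / 2 : ℝ)) := by
  obtain ⟨c, hc, hG⟩ := exists_Gamma_lower_bound
  refine ⟨96 * 18 / c, fun s hs1 hs2 t hst X Y hXY => ?_⟩
  obtain ⟨hX, hY, hYU⟩ := id hXY
  have hYX : Y ≤ X := hYU.le.trans (sqrt_bounds hX).2.2.1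
  have hX0 : 0 < X := by linarith
  have hμ : Complex.I * t = ((s - 1 / 2 : ℝ) : ℂ) := by push_cast; linear_combination -hst
  have ht : t = -Complex.I * ((s - 1 / 2 : ℝ) : ℂ) := by
    rw [← hμ, ← mul_assoc, neg_mul, Complex.I_mul_I]; ring
  have hsp : SpectralParam t := by
    right
    have e1 : t.re = 0 := by rw [ht]; simp
    have e2 : t.im = -(s - 1 / 2) := by rw [ht]; simp
    rw [e2]
    exact ⟨e1, by linarith, by linarith⟩
  have h := norm_huberTransform_sub_le hsp hXY
  have hn : ‖t‖ = s - 1 / 2 := by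
    rw [ht, norm_mul, norm_neg, Complex.norm_I, one_mul, Complex.norm_real,
      Real.norm_of_nonneg (by linarith)]
  set m := s - 1 / 2 with hm
  have hm0 : 0 < m := by linarith
  have hm0c : (m : ℂ) ≠ 0 := by exact_mod_cast hm0.ne'
  rw [hn, hμ] at h
  have es : (s : ℂ) = 1 / 2 + (m : ℂ) := by rw [hm]; push_cast; ring
  rw [show (3 / 2 + (m : ℂ)) = s + 1 by rw [es]; ring,
    show (3 / 2 - (m : ℂ)) = 2 - s by rw [es]; ring,
    show (1 / 2 - (m : ℂ)) = 1 - s by rw [es]; ring, ← es] at h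
  refine h.trans ?_
  have mB := coeffB_mul (μ := m) (by simp; linarith) (by simp; linarith) hm0c
  have mD := coeffD_mul (μ := m) (by simp; linarith) (by simp; linarith) hm0c
  have aB := norm_amp_le (μ := m) (by simp; linarith) (by simp; linarith)
  have aD := norm_amp_le (μ := -m) (by simp; linarith) (by simp; linarith)
  have nm : ‖(m : ℂ)‖ = m := by rw [Complex.norm_real, Real.norm_of_nonneg hm0.le]
  rw [norm_neg, nm] at aD
  rw [nm] at aB
  have bB : ‖coeffB s‖ ≤ 3 / m := by
    refine le_trans ?_ aB
    rw [← mB, norm_mul, ← es]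
    refine le_mul_of_one_le_right (norm_nonneg _) ?_
    rw [show (3 / 2 + (m : ℂ)) = ((3 / 2 + m : ℝ) : ℂ) by push_cast; ring, Complex.norm_real,
      Real.norm_of_nonneg (by linarith)]
    linarith
  have bD : ‖coeffD s‖ ≤ 3 / m := by
    refine le_trans ?_ aD
    rw [← mD, norm_mul, ← es]
    refine le_mul_of_one_le_right (norm_nonneg _) ?_
    rw [show (3 / 2 - (m : ℂ)) = ((3 / 2 - m : ℝ) : ℂ) by push_cast; ring, Complex.norm_real,
      Real.norm_of_nonneg (by linarith)]
    linarith
  have pB : ‖(X : ℂ) ^ (-(1 / 2) + (m : ℂ))‖ ≤ 1 := by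
    rw [Complex.norm_cpow_eq_rpow_re_of_pos hX0]
    exact Real.rpow_le_one_of_one_le_of_nonpos (by linarith) (by simp; linarith)
  have pD : ‖(X : ℂ) ^ (-(1 / 2) - (m : ℂ))‖ ≤ X ^ (1 / 2 : ℝ) / X := by
    rw [Complex.norm_cpow_eq_rpow_re_of_pos hX0, ← Real.rpow_sub_one hX0.ne']
    exact Real.rpow_le_rpow_of_exponent_le (by linarith) (by simp; linarith)
  have g1 : c / m ≤ |Real.Gamma m| := by
    have := hG (m + 1) ⟨by linarith, by linarith⟩
    rw [Real.Gamma_add_one hm0.ne'] at this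
    rw [div_le_iff₀ hm0, mul_comm]
    exact this.trans (by gcongr; exact le_abs_self _)
  have g2 : c / m ≤ |Real.Gamma (1 / 2 - s)| := by
    have := hG (-m + 1) ⟨by linarith, by linarith⟩
    rw [Real.Gamma_add_one (neg_ne_zero.2 hm0.ne')] at this
    rw [div_le_iff₀ hm0, show 1 / 2 - s = -m by rw [hm]; ring]
    calc c ≤ m * -Real.Gamma (-m) := by linarith
      _ ≤ m * |Real.Gamma (-m)| := by gcongr; exact neg_le_abs _
      _ = _ := mul_comm _ _
  have hX1 : X⁻¹ ≤ 1 := inv_le_one_of_one_le₀ (by linarith)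
  have hXh : 1 ≤ X ^ (1 / 2 : ℝ) := Real.one_le_rpow (by linarith) (by norm_num)
  have hm1 : 1 + m ^ 2 ≤ 2 := by nlinarith
  rw [norm_mul, norm_mul]
  -- The first wave contributes Y + X⁻¹, with X⁻¹ ≤ X^(1/2). In the second, (Y + X⁻¹)/X ≤ 2 leaves
  -- only X^(1/2).
  calc _ ≤ 96 * (3 / m * 1 + 3 / m * (X ^ (1 / 2 : ℝ) / X)) * 2 * (Y + X⁻¹) := by gcongr
    _ = 96 * 6 / m * (Y + X⁻¹ + X ^ (1 / 2 : ℝ) * ((Y + X⁻¹) / X)) := by field_simp; ring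
    _ ≤ 96 * 6 / m * (Y + X ^ (1 / 2 : ℝ) + X ^ (1 / 2 : ℝ) * 2) := by
        gcongr
        · linarith
        · rw [div_le_iff₀ hX0]; linarith
    _ ≤ 96 * 6 / m * (3 * (Y + X ^ (1 / 2 : ℝ))) := by gcongr; linarith
    _ = 96 * 18 / c * (c / m * Y + c / m * X ^ (1 / 2 : ℝ)) := by field_simp; ring
    _ ≤ _ := by gcongr

/-! ### Purely imaginary parameters -/

/-- The coefficient of `X ^ (1/2 + μ)` in the transform of `f⁺`. -/
def waveCoeff (μ : ℂ) (X Y : ℝ) : ℂ :=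
  amp μ * ((X : ℂ) ^ (-(1 / 2 + μ)) * mean X Y (jost μ))

/-- The main term of `waveCoeff`, as a function of `y = Y / X`. -/
def waveMain (μ : ℂ) (y : ℝ) : ℂ :=
  amp μ * ((((1 + y : ℝ) : ℂ) ^ (3 / 2 + μ) - 1) / (y * (3 / 2 + μ)))

theorem norm_cpow_neg_half {μ : ℂ} (h : μ.re = 0) {X : ℝ} (hX : 0 < X) :
    ‖(X : ℂ) ^ (-(1 / 2 + μ))‖ = (√X)⁻¹ := by
  rw [Complex.norm_cpow_eq_rpow_re_of_pos hX, Real.sqrt_eq_rpow, ← Real.rpow_neg hX.le]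
  simp [h]

theorem norm_le_min {a m v k : ℝ} (hm : 0 < m) (h1 : a ≤ k / m)
    (h2 : a ≤ k * v / m ^ 2) : a ≤ k * ((m ^ 2)⁻¹ * min m v) := by
  rcases le_total m v with h | h
  · rw [min_eq_left h]
    refine h1.trans_eq ?_
    field_simp
  · rw [min_eq_right h]
    refine h2.trans_eq ?_
    field_simp

theorem norm_re_zero_le {μ : ℂ} (h : μ.re = 0) : ‖μ‖ ≤ ‖3 / 2 + μ‖ := by
  have h1 := Complex.abs_im_le_norm (3 / 2 + μ)
  have h2 := Complex.norm_le_abs_re_add_abs_im μ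
  rw [h, abs_zero, zero_add] at h2
  simp at h1
  exact h2.trans h1

theorem norm_mean_jost_le {μ : ℂ} (h : μ.re = 0) {X Y : ℝ} (hXY : Admissible X Y) :
    ‖mean X Y (jost μ)‖ ≤ 6 * √X := by
  obtain ⟨hX, hY, hYU⟩ := hXY
  obtain ⟨u1, u2, u3, u4⟩ := sqrt_bounds hX
  refine norm_mean_le hY fun x hx => ?_
  have hx1 := u1.trans hx.1
  refine (norm_jost_le h (by linarith)).trans ?_
  have h2 : √(rad x) ≤ 2 * √X := by
    rw [show 2 * √X = √(4 * X) by
      rw [Real.sqrt_mul (by norm_num), show (4 : ℝ) = 2 ^ 2 by norm_num,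
        Real.sqrt_sq (by norm_num)]]
    exact Real.sqrt_le_sqrt ((rad_le hx1).trans (by linarith [hx.2]))
  linarith

/-- The primitive of a solution `f`, up to the factor `-(2 + λ)`. -/
theorem IsSol.integral_eq {lam : ℂ} {f f' : ℝ → ℂ} (hf : IsSol lam f f') (a b : ℝ) :
    (2 + lam) * ∫ x in a..b, f x =
      ((1 + (a : ℂ) ^ 2) * f' a - 2 * a * f a) - ((1 + (b : ℂ) ^ 2) * f' b - 2 * b * f b) := by
  have hd : ∀ x : ℝ, HasDerivAt (fun x : ℝ => (1 + (x : ℂ) ^ 2) * f' x - 2 * x * f x)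
      (-((2 + lam) * f x)) x := fun x => by
    have h1 : HasDerivAt (fun x : ℝ => (x : ℂ)) 1 x := (hasDerivAt_id x).ofReal_comp
    refine ((((h1.pow 2).const_add 1).mul (hf x).2).sub
      ((h1.const_mul 2).mul (hf x).1)).congr_deriv ?_
    have := one_add_sq_ne_zero x
    simp only [Pi.pow_apply]
    field_simp
    ring
  have hi := intervalIntegral.integral_eq_sub_of_hasDerivAt (a := a) (b := b) (fun x _ => hd x)
    ((hf.continuous.const_mul _).neg.intervalIntegrable _ _)
  rw [intervalIntegral.integral_neg, intervalIntegral.integral_const_mul] at hi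
  linear_combination -hi

/-- Cancellation from oscillation: `IsSol.integral_eq` expresses the integral by boundary terms of
size (1 + |μ|)X^(3/2), divided by 2 + λ. -/
theorem norm_mean_jost_le' {μ : ℂ} (h : μ.re = 0) (h0 : μ ≠ 0) {X Y : ℝ}
    (hXY : Admissible X Y) :
    ‖mean X Y (jost μ)‖ ≤ 352 * X * √X / (Y * ‖μ‖) := by
  obtain ⟨hX, hY, hYU⟩ := hXY
  obtain ⟨u1, u2, u3, u4⟩ := sqrt_bounds hX
  have hm : 0 < ‖μ‖ := norm_pos_iff.2 h0
  have key := (isSol_jost (μ := μ) (by linarith)).integral_eq √(X ^ 2 - 1) (√(X ^ 2 - 1) + Y)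
  have bd : ∀ x : ℝ, 1 ≤ x → x ≤ 2 * X →
      ‖(1 + (x : ℂ) ^ 2) * jostDeriv μ x - 2 * x * jost μ x‖ ≤ 88 * (1 + ‖μ‖) * (X * √X) := by
    intro x hx1 hx2
    have b1 := norm_jostDeriv_le h (by linarith : 0 ≤ x)
    have b2 := norm_jost_le h (by linarith : 0 ≤ x)
    have hr := rad_pos x
    have hsr := Real.sqrt_pos.2 hr
    have hxr := (abs_lt.1 (abs_lt_rad x)).2
    have hrX : rad x ≤ 4 * X := (rad_le hx1).trans (by linarith)
    have hsX : √(rad x) ≤ 2 * √X := by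
      rw [show 2 * √X = √(4 * X) by
        rw [Real.sqrt_mul (by norm_num), show (4 : ℝ) = 2 ^ 2 by norm_num,
          Real.sqrt_sq (by norm_num)]]
      exact Real.sqrt_le_sqrt hrX
    have e1 : ‖(1 + (x : ℂ) ^ 2)‖ = rad x * (√(rad x) * √(rad x)) := by
      rw [Real.mul_self_sqrt hr.le, ← sq, rad_sq,
        show (1 + (x : ℂ) ^ 2) = ((1 + x ^ 2 : ℝ) : ℂ) by push_cast; ring, Complex.norm_real,
        Real.norm_of_nonneg (by positivity)]
    have e2 : ‖(2 * x : ℂ)‖ ≤ 2 * rad x := by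
      rw [norm_mul, Complex.norm_real, Real.norm_of_nonneg (by linarith)]
      norm_num; exact hxr.le
    refine (norm_sub_le _ _).trans ?_
    rw [norm_mul, norm_mul (2 * (x : ℂ)), e1]
    calc _ ≤ rad x * (√(rad x) * √(rad x)) * (5 * (1 + ‖μ‖) * (√(rad x))⁻¹) +
          2 * rad x * (3 * √(rad x)) := by gcongr
      _ = (11 + 5 * ‖μ‖) * (rad x * √(rad x)) := by field_simp; ring
      _ ≤ (11 * (1 + ‖μ‖)) * (4 * X * (2 * √X)) := by gcongr; linarith
      _ = _ := by ring
  have hb := norm_sub_le_of_le (bd _ u1 (by linarith)) (bd _ (u1.trans (by linarith))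
    (by linarith : √(X ^ 2 - 1) + Y ≤ 2 * X))
  rw [← key, norm_mul] at hb
  -- For imaginary μ, 2 + λ = 9/4 + |μ|², so the division gains a factor |μ| over the boundary
  -- terms.
  have hlam : 9 / 4 + ‖μ‖ ^ 2 ≤ ‖2 + (1 / 4 - μ ^ 2)‖ := by
    refine le_trans (le_of_eq ?_) (Complex.re_le_norm _)
    rw [← Complex.normSq_eq_norm_sq, Complex.normSq_apply]
    simp [sq, h]; ring
  have hI : ‖∫ x in √(X ^ 2 - 1)..(√(X ^ 2 - 1) + Y), jost μ x‖ ≤ 352 * (X * √X) / ‖μ‖ := by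
    set J := ‖∫ x in √(X ^ 2 - 1)..(√(X ^ 2 - 1) + Y), jost μ x‖
    have hJ : 0 ≤ J := norm_nonneg _
    have h3 : (9 / 4 + ‖μ‖ ^ 2) * J ≤ 176 * (1 + ‖μ‖) * (X * √X) := by
      calc _ ≤ ‖2 + (1 / 4 - μ ^ 2)‖ * J := by gcongr
        _ ≤ _ := hb
        _ = _ := by ring
    rw [le_div_iff₀ hm]
    have hq : 0 ≤ X * √X := by positivity
    have h4 : ‖μ‖ * (1 + ‖μ‖) ≤ 2 * (9 / 4 + ‖μ‖ ^ 2) := by nlinarith [sq_nonneg (‖μ‖ - 1)]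
    have h5 : (9 / 4 + ‖μ‖ ^ 2) * (J * ‖μ‖) ≤ (9 / 4 + ‖μ‖ ^ 2) * (352 * (X * √X)) := by
      calc _ = (9 / 4 + ‖μ‖ ^ 2) * J * ‖μ‖ := by ring
        _ ≤ 176 * (1 + ‖μ‖) * (X * √X) * ‖μ‖ := by gcongr
        _ = 176 * (X * √X) * (‖μ‖ * (1 + ‖μ‖)) := by ring
        _ ≤ 176 * (X * √X) * (2 * (9 / 4 + ‖μ‖ ^ 2)) := by gcongr
        _ = _ := by ring
    exact le_of_mul_le_mul_left h5 (by positivity)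
  rw [mean, norm_mul, norm_inv, Complex.norm_real, Real.norm_of_nonneg hY.le]
  calc _ ≤ Y⁻¹ * (352 * (X * √X) / ‖μ‖) := by gcongr
    _ = _ := by field_simp

theorem norm_waveCoeff_le {μ : ℂ} (h : μ.re = 0) (h0 : μ ≠ 0) {X Y : ℝ}
    (hXY : Admissible X Y) :
    ‖waveCoeff μ X Y‖ ≤ 1056 * ((‖μ‖ ^ 2)⁻¹ * min ‖μ‖ (X / Y)) := by
  have hX0 : 0 < X := by linarith [hXY.1]
  have hY := hXY.2.1
  have hm : 0 < ‖μ‖ := norm_pos_iff.2 h0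
  have hs := Real.sqrt_pos.2 hX0
  have b0 := norm_amp_le (μ := μ) (by linarith) (by linarith)
  have e : ‖waveCoeff μ X Y‖ = ‖amp μ‖ * ((√X)⁻¹ * ‖mean X Y (jost μ)‖) := by
    rw [waveCoeff, norm_mul, norm_mul, norm_cpow_neg_half h hX0]
  rw [e]
  refine norm_le_min hm ?_ ?_
  · calc _ ≤ 3 / ‖μ‖ * ((√X)⁻¹ * (6 * √X)) := by
          gcongr; exact norm_mean_jost_le h hXY
      _ = 18 / ‖μ‖ := by field_simp; norm_num
      _ ≤ _ := by gcongr; norm_num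
  · calc _ ≤ 3 / ‖μ‖ * ((√X)⁻¹ * (352 * X * √X / (Y * ‖μ‖))) := by
          gcongr; exact norm_mean_jost_le' h h0 hXY
      _ = _ := by field_simp; norm_num

/-- The power difference is O(|s + 1|·y) by the mean value inequality and O(1) trivially. The
constant 1056 is larger than needed and matches `norm_waveCoeff_le`. -/
theorem norm_waveMain_le {μ : ℂ} (h : μ.re = 0) (h0 : μ ≠ 0) {y : ℝ} (hy : 0 < y) (hy1 : y ≤ 1) :
    ‖waveMain μ y‖ ≤ 1056 * ((‖μ‖ ^ 2)⁻¹ * min ‖μ‖ (1 / y)) := by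
  have hm : 0 < ‖μ‖ := norm_pos_iff.2 h0
  have b0 := norm_amp_le (μ := μ) (by linarith) (by linarith)
  have hms := norm_re_zero_le h
  have hs : 0 < ‖3 / 2 + μ‖ := hm.trans_le hms
  have e : ‖waveMain μ y‖ =
      ‖amp μ‖ * (‖((1 + y : ℝ) : ℂ) ^ (3 / 2 + μ) - 1‖ / (y * ‖3 / 2 + μ‖)) := by
    rw [waveMain, norm_mul, norm_div, norm_mul, Complex.norm_real, Real.norm_of_nonneg hy.le]
  have hre : (3 / 2 + μ).re = 3 / 2 := by simp [h]
  have c1 : ‖((1 + y : ℝ) : ℂ) ^ (3 / 2 + μ) - 1‖ ≤ ‖3 / 2 + μ‖ * 2 * y := by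
    have := norm_cpow_sub_cpow_le (s := 3 / 2 + μ) (x := 1) (y := 1 + y) (L := 2) one_pos
      (by linarith) (fun u hu => ?_)
    · simpa [abs_of_pos hy] using this
    · rw [uIcc_of_le (by linarith)] at hu
      rw [hre]
      calc u ^ (3 / 2 - 1 : ℝ) ≤ u ^ (1 : ℝ) :=
            Real.rpow_le_rpow_of_exponent_le hu.1 (by norm_num)
        _ ≤ 2 := by rw [Real.rpow_one]; linarith [hu.2]
  have c2 : ‖((1 + y : ℝ) : ℂ) ^ (3 / 2 + μ) - 1‖ ≤ 5 := by
    refine (norm_sub_le _ _).trans ?_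
    rw [Complex.norm_cpow_eq_rpow_re_of_pos (by linarith), hre, norm_one]
    have : (1 + y) ^ (3 / 2 : ℝ) ≤ 4 := by
      calc (1 + y) ^ (3 / 2 : ℝ) ≤ (1 + y) ^ (2 : ℝ) :=
            Real.rpow_le_rpow_of_exponent_le (by linarith) (by norm_num)
        _ = (1 + y) ^ 2 := by norm_num
        _ ≤ _ := by nlinarith
    linarith
  rw [e]
  refine norm_le_min hm ?_ ?_
  · calc _ ≤ 3 / ‖μ‖ * (‖3 / 2 + μ‖ * 2 * y / (y * ‖3 / 2 + μ‖)) := by gcongr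
      _ = 6 / ‖μ‖ := by generalize ‖3 / 2 + μ‖ = w at hs; field_simp; norm_num
      _ ≤ _ := by gcongr; norm_num
  · calc _ ≤ 3 / ‖μ‖ * (5 / (y * ‖μ‖)) := by gcongr
      _ = 15 * (1 / y) / ‖μ‖ ^ 2 := by field_simp; norm_num
      _ ≤ _ := by gcongr; norm_num

/-- Translation by X − U carries [U, U + Y] to [X, X + Y]; after scaling by X only the ratio Y/X
survives, so the main term in (b) depends on t and Y/X alone. -/
theorem mean_shifted_cpow {μ : ℂ} (h : μ.re = 0) {X Y : ℝ} (hX : 0 < X) (hY : 0 < Y) :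
    (X : ℂ) ^ (-(1 / 2 + μ)) *
      mean X Y (fun x => ((x + (X - √(X ^ 2 - 1)) : ℝ) : ℂ) ^ (1 / 2 + μ)) =
    (((1 + Y / X : ℝ) : ℂ) ^ (3 / 2 + μ) - 1) / ((Y / X : ℝ) * (3 / 2 + μ)) := by
  have hXc : (X : ℂ) ≠ 0 := by exact_mod_cast hX.ne'
  have hYc : (Y : ℂ) ≠ 0 := by exact_mod_cast hY.ne'
  have hs : (3 / 2 + μ : ℂ) ≠ 0 := fun h' => by
    have := congrArg Complex.re h'
    simp [h] at this
  have hi := intervalIntegral.integral_comp_add_right (a := √(X ^ 2 - 1)) (b := √(X ^ 2 - 1) + Y)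
    (fun x : ℝ => (x : ℂ) ^ (1 / 2 + μ)) (X - √(X ^ 2 - 1))
  rw [show √(X ^ 2 - 1) + (X - √(X ^ 2 - 1)) = X by ring,
    show √(X ^ 2 - 1) + Y + (X - √(X ^ 2 - 1)) = X + Y by ring,
    integral_cpow (Or.inl (by simp [h]; norm_num)),
    show 1 / 2 + μ + 1 = 3 / 2 + μ by ring] at hi
  have e1 : ((X + Y : ℝ) : ℂ) ^ (3 / 2 + μ) =
      (X : ℂ) ^ (3 / 2 + μ) * ((1 + Y / X : ℝ) : ℂ) ^ (3 / 2 + μ) := by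
    rw [← Complex.mul_cpow_ofReal_nonneg hX.le (by positivity), ← Complex.ofReal_mul]
    congr 2; field_simp
  have e2 : (X : ℂ) ^ (3 / 2 + μ) = (X : ℂ) ^ (1 / 2 + μ) * X := by
    rw [show 3 / 2 + μ = 1 / 2 + μ + 1 by ring, Complex.cpow_add _ _ hXc, Complex.cpow_one]
  have e3 : (X : ℂ) ^ (1 / 2 + μ) ≠ 0 := by simp [Complex.cpow_eq_zero_iff, hXc]
  rw [mean, hi, e1, e2, Complex.cpow_neg]
  generalize ((1 + Y / X : ℝ) : ℂ) ^ (3 / 2 + μ) = k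
  generalize (X : ℂ) ^ (1 / 2 + μ) = v at e3 ⊢
  generalize 3 / 2 + μ = w at hs ⊢
  push_cast
  field_simp

/-- The translation by X − U ≤ 1/X costs no more than replacing `jost` by a pure power; either error
is O(X⁻²) relative to the wave, up to 1 + |μ|. -/
theorem norm_waveCoeff_sub_le {μ : ℂ} (h : μ.re = 0) (h0 : μ ≠ 0) {X Y : ℝ}
    (hXY : Admissible X Y) :
    ‖waveCoeff μ X Y - waveMain μ (Y / X)‖ ≤ 1056 * ((1 + ‖μ‖⁻¹) * (X ^ 2)⁻¹) := by
  obtain ⟨hX, hY, hYU⟩ := hXY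
  obtain ⟨u1, u2, u3, u4⟩ := sqrt_bounds hX
  have hX0 : 0 < X := by linarith
  have hs := Real.sqrt_pos.2 hX0
  have hm : 0 < ‖μ‖ := norm_pos_iff.2 h0
  have b0 := norm_amp_le (μ := μ) (by linarith) (by linarith)
  have hcont : ContinuousOn
      (fun x : ℝ => ((x + (X - √(X ^ 2 - 1)) : ℝ) : ℂ) ^ (1 / 2 + μ))
      (uIcc √(X ^ 2 - 1) (√(X ^ 2 - 1) + Y)) := by
    refine ContinuousOn.cpow (by fun_prop) continuousOn_const fun x hx => ?_
    rw [uIcc_of_le (by linarith)] at hx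
    exact Complex.ofReal_mem_slitPlane.2 (by linarith [hx.1])
  have b1 : ‖mean X Y (fun x => jost μ x -
      ((x + (X - √(X ^ 2 - 1)) : ℝ) : ℂ) ^ (1 / 2 + μ))‖ ≤
      32 * (1 + ‖μ‖) * ((√X)⁻¹ * X⁻¹) := by
    refine norm_mean_le hY fun x hx => (norm_jost_sub_cpow_le (by linarith) (by linarith) hX0
      (u1.trans hx.1) (u2.trans hx.1) (by linarith [hx.1])).trans ?_
    have e : |x - (x + (X - √(X ^ 2 - 1)))| ≤ X⁻¹ := by
      rw [sub_add_cancel_left, abs_neg, abs_of_nonneg (by linarith)]; exact u4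
    have e2 : X ^ (μ.re - 1 / 2) = (√X)⁻¹ := by
      rw [h, Real.sqrt_eq_rpow, ← Real.rpow_neg hX0.le]; norm_num
    rw [e2]
    calc _ ≤ 16 * (1 + ‖μ‖) * (√X)⁻¹ * (X⁻¹ + X⁻¹) := by gcongr
      _ = _ := by ring
  have hd : waveCoeff μ X Y - waveMain μ (Y / X) = amp μ * ((X : ℂ) ^ (-(1 / 2 + μ)) *
      mean X Y (fun x => jost μ x - ((x + (X - √(X ^ 2 - 1)) : ℝ) : ℂ) ^ (1 / 2 + μ))) := by
    rw [mean_sub (continuous_jost (by linarith)) hcont.intervalIntegrable, mul_sub (_ ^ _),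
      mean_shifted_cpow h hX0 hY, waveCoeff, waveMain]
    ring
  rw [hd, norm_mul, norm_mul, norm_cpow_neg_half h hX0]
  calc _ ≤ 3 / ‖μ‖ * ((√X)⁻¹ * (32 * (1 + ‖μ‖) * ((√X)⁻¹ * X⁻¹))) := by gcongr
    _ = 96 * ((1 + ‖μ‖⁻¹) * ((√X * √X)⁻¹ * X⁻¹)) := by field_simp; ring
    _ = 96 * ((1 + ‖μ‖⁻¹) * (X ^ 2)⁻¹) := by
        rw [Real.mul_self_sqrt hX0.le, ← mul_inv, ← sq]
    _ ≤ _ := by gcongr; norm_num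

theorem huberTransform_eq_waves {t : ℝ} (ht : t ≠ 0) {X Y : ℝ} (hXY : Admissible X Y) :
    huberTransform (fPlus X Y) t =
      waveCoeff (Complex.I * t) X Y * (X : ℂ) ^ (1 / 2 + Complex.I * t) +
        waveCoeff (-(Complex.I * t)) X Y * (X : ℂ) ^ (1 / 2 - Complex.I * t) := by
  have hX0 : 0 < X := by linarith [hXY.1]
  have hXc : (X : ℂ) ≠ 0 := by exact_mod_cast hX0.ne'
  have e : ∀ s : ℂ, (X : ℂ) ^ (-s) * (X : ℂ) ^ s = 1 := fun s => by
    rw [← Complex.cpow_add _ _ hXc, neg_add_cancel, Complex.cpow_zero]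
  rw [huberTransform_eq (by simp) (by simp) (by exact_mod_cast ht) hXY, waveCoeff, waveCoeff,
    sub_eq_add_neg (1 / 2) (Complex.I * (t : ℂ))]
  linear_combination
    (-amp (Complex.I * t) * mean X Y (jost (Complex.I * t))) * e (1 / 2 + Complex.I * t) -
    amp (-(Complex.I * t)) * mean X Y (jost (-(Complex.I * t))) * e (1 / 2 + -(Complex.I * t))

theorem norm_huberTransform_le {t : ℝ} (ht : t ≠ 0) {X Y : ℝ} (hXY : Admissible X Y) :
    ‖huberTransform (fPlus X Y) t‖ ≤
      2112 * ((t ^ 2)⁻¹ * min |t| (X / Y) * X ^ (1 / 2 : ℝ)) := by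
  have hX0 : 0 < X := by linarith [hXY.1]
  have hμ : Complex.I * (t : ℂ) ≠ 0 := mul_ne_zero Complex.I_ne_zero (by exact_mod_cast ht)
  have n1 := norm_waveCoeff_le (μ := Complex.I * t) (by simp) hμ hXY
  have n2 := norm_waveCoeff_le (μ := -(Complex.I * t)) (by simp) (neg_ne_zero.2 hμ) hXY
  have hn : ‖Complex.I * (t : ℂ)‖ = |t| := by simp
  rw [hn, sq_abs] at n1
  rw [norm_neg, hn, sq_abs] at n2
  have p1 : ‖(X : ℂ) ^ (1 / 2 + Complex.I * (t : ℂ))‖ = X ^ (1 / 2 : ℝ) := by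
    rw [Complex.norm_cpow_eq_rpow_re_of_pos hX0]; simp
  have p2 : ‖(X : ℂ) ^ (1 / 2 - Complex.I * (t : ℂ))‖ = X ^ (1 / 2 : ℝ) := by
    rw [Complex.norm_cpow_eq_rpow_re_of_pos hX0]; simp
  rw [huberTransform_eq_waves ht hXY]
  refine (norm_add_le _ _).trans ?_
  rw [norm_mul, norm_mul, p1, p2]
  calc _ ≤ 1056 * ((t ^ 2)⁻¹ * min |t| (X / Y)) * X ^ (1 / 2 : ℝ) +
        1056 * ((t ^ 2)⁻¹ * min |t| (X / Y)) * X ^ (1 / 2 : ℝ) := by gcongr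
    _ = _ := by ring

/-! ### The parameter `t = 0` -/

/-- Variation of constants against the Euler equation x²h'' + h/4 = 0. Writing h = √x(p + q·log x),
the derivatives of p and q are so small that p and q remain bounded. -/
theorem exists_abs_le_of_ode {h f : ℝ → ℝ} (dh : ∀ x, HasDerivAt h (f x) x)
    (df : ∀ x, HasDerivAt f (-(1 / 4) / (1 + x ^ 2) * h x) x) :
    ∃ C : ℝ, 0 ≤ C ∧ ∀ x, 1 ≤ x → |h x| ≤ C * (√x * (1 + Real.log x)) := by
  set q : ℝ → ℝ := fun x => √x * f x - h x / (2 * √x) with hq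
  set p : ℝ → ℝ := fun x => h x / √x - q x * Real.log x with hp
  set m : ℝ → ℝ := fun x => p x ^ 2 + q x ^ 2 with hm
  -- The energy m = p² + q² satisfies m' ≤ (5/2)x⁻²m for x ≥ 1, and exp(5/(2x)) is the integrating
  -- factor that makes the product decrease.
  set G : ℝ → ℝ := fun x => m x * Real.exp (5 / 2 / x) with hG
  have hpq : ∀ x, 0 < x → h x = √x * (p x + q x * Real.log x) := fun x hx => by
    have := (Real.sqrt_pos.2 hx).ne'
    simp only [hp]; field_simp; ring
  have dq : ∀ x, 0 < x →
      HasDerivAt q ((p x + q x * Real.log x) / (4 * x * (1 + x ^ 2))) x := fun x hx => by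
    have hs := (Real.sqrt_pos.2 hx).ne'
    have hs2 := Real.sq_sqrt hx.le
    have dsq := Real.hasDerivAt_sqrt hx.ne'
    refine ((dsq.mul (df x)).sub ((dh x).div (dsq.const_mul 2) (by positivity))).congr_deriv ?_
    have e : p x + q x * Real.log x = h x / √x := by rw [hpq x hx]; field_simp
    rw [e]
    have hx' := hx.ne'
    generalize √x = r at *
    subst hs2
    field_simp
    ring
  have dp : ∀ x, 0 < x → HasDerivAt p
      (-((p x + q x * Real.log x) / (4 * x * (1 + x ^ 2)) * Real.log x)) x := fun x hx => by
    have hs := (Real.sqrt_pos.2 hx).ne'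
    have hs2 := Real.sq_sqrt hx.le
    have dsq := Real.hasDerivAt_sqrt hx.ne'
    refine (((dh x).div dsq hs).sub ((dq x hx).mul (Real.hasDerivAt_log hx.ne'))).congr_deriv ?_
    have e : q x * x⁻¹ = (f x * √x - h x * (1 / (2 * √x))) / √x ^ 2 := by
      rw [hs2]; simp only [hq]; field_simp
    rw [e]; ring
  have dG : ∀ x, 0 < x → HasDerivAt G
      ((2 * (p x + q x * Real.log x) * (q x - p x * Real.log x) / (4 * x * (1 + x ^ 2)) -
        5 / 2 / x ^ 2 * m x) * Real.exp (5 / 2 / x)) x := fun x hx => by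
    have d1 := (((dp x hx).pow 2).add ((dq x hx).pow 2))
    have d2 := (((hasDerivAt_inv hx.ne').const_mul (5 / 2)).exp)
    have hx' := hx.ne'
    have hfun : G = fun x => (p x ^ 2 + q x ^ 2) * Real.exp (5 / 2 * x⁻¹) := by
      funext x; simp only [hG, hm, div_eq_mul_inv]
    rw [hfun]
    refine (d1.mul d2).congr_deriv ?_
    simp only [hm, Pi.add_apply, Pi.pow_apply, div_eq_mul_inv]
    field_simp
    ring
  have anti : AntitoneOn G (Ici 1) := by
    refine antitoneOn_of_deriv_nonpos (convex_Ici 1) (fun x hx =>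
      (dG x (by linarith [mem_Ici.1 hx])).continuousAt.continuousWithinAt) (fun x hx => ?_)
      fun x hx => ?_
    · rw [interior_Ici] at hx
      exact (dG x (by linarith [mem_Ioi.1 hx])).differentiableAt.differentiableWithinAt
    · rw [interior_Ici] at hx
      have hx1 : 1 < x := hx
      have hx0 : 0 < x := by linarith
      rw [(dG x hx0).deriv]
      refine mul_nonpos_of_nonpos_of_nonneg (sub_nonpos.2 ?_) (Real.exp_pos _).le
      have hl0 : 0 ≤ Real.log x := Real.log_nonneg hx1.le
      -- From log x = 2·log √x ≤ 2(√x − 1).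
      have hl : Real.log x ^ 2 ≤ 4 * x := by
        have h1 := Real.log_le_sub_one_of_pos (Real.sqrt_pos.2 hx0)
        rw [Real.log_sqrt hx0.le] at h1
        have h2 := Real.sq_sqrt hx0.le
        have h3 := Real.sqrt_nonneg x
        nlinarith
      have hm0 : 0 ≤ m x := by simp only [hm]; positivity
      -- The squares of the two factors p + q·log x and q − p·log x add up to (1 + log² x)·m.
      have h1 : 2 * (p x + q x * Real.log x) * (q x - p x * Real.log x) ≤
          2 * (1 + Real.log x ^ 2) * m x := by
        simp only [hm]
        nlinarith [sq_nonneg ((p x + q x * Real.log x) - (q x - p x * Real.log x)),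
          sq_nonneg (p x + q x * Real.log x), sq_nonneg (q x - p x * Real.log x)]
      rw [div_le_iff₀ (by positivity)]
      refine h1.trans ?_
      have h2 : 2 * (1 + Real.log x ^ 2) ≤ 5 / 2 / x ^ 2 * (4 * x * (1 + x ^ 2)) := by
        have e : 5 / 2 / x ^ 2 * (4 * x * (1 + x ^ 2)) = 10 * (1 + x ^ 2) / x := by
          field_simp; norm_num
        rw [e, le_div_iff₀ hx0]
        nlinarith
      nlinarith
  refine ⟨√(G 1), Real.sqrt_nonneg _, fun x hx => ?_⟩
  have hx0 : 0 < x := by linarith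
  have hl0 : 0 ≤ Real.log x := Real.log_nonneg hx
  have hle : m x ≤ G 1 := by
    refine le_trans ?_ (anti self_mem_Ici hx hx)
    have h1 : 1 ≤ Real.exp (5 / 2 / x) := Real.one_le_exp (by positivity)
    have hm0 : 0 ≤ m x := by simp only [hm]; positivity
    exact le_mul_of_one_le_right hm0 h1
  have hp1 : |p x| ≤ √(G 1) := Real.abs_le_sqrt (by simp only [hm] at hle; nlinarith [sq_nonneg (q x)])
  have hq1 : |q x| ≤ √(G 1) := Real.abs_le_sqrt (by simp only [hm] at hle; nlinarith [sq_nonneg (p x)])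
  rw [hpq x hx0, abs_mul, abs_of_nonneg (Real.sqrt_nonneg x)]
  have h2 : |p x + q x * Real.log x| ≤ √(G 1) + √(G 1) * Real.log x := by
    refine (abs_add_le _ _).trans ?_
    rw [abs_mul, abs_of_nonneg hl0]
    gcongr
  calc _ ≤ √x * (√(G 1) + √(G 1) * Real.log x) := by gcongr
    _ = _ := by ring

theorem exists_norm_huberTransform_zero_le :
    ∃ C : ℝ, ∀ X Y : ℝ, Admissible X Y →
      ‖huberTransform (fPlus X Y) 0‖ ≤ C * (X ^ (1 / 2 : ℝ) * Real.log X) := by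
  obtain ⟨H, hH, H0, -⟩ := exists_isSol_xi (1 / 4 + 0 ^ 2)
  set F := fun x => xi (1 / 4 + 0 ^ 2) (Real.arctan x) with hF
  have hcoef : ∀ x : ℝ, -(1 / 4 + 0 ^ 2) / (1 + (x : ℂ) ^ 2) * H x =
      ((-(1 / 4) / (1 + x ^ 2) : ℝ) : ℂ) * H x := fun x => by push_cast; ring
  have dre : ∀ {g : ℝ → ℂ} {g' : ℂ} {x : ℝ}, HasDerivAt g g' x →
      HasDerivAt (fun x => (g x).re) g'.re x := fun hg =>
    (Complex.reCLM.hasFDerivAt.comp_hasDerivAt _ hg)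
  have dim : ∀ {g : ℝ → ℂ} {g' : ℂ} {x : ℝ}, HasDerivAt g g' x →
      HasDerivAt (fun x => (g x).im) g'.im x := fun hg =>
    (Complex.imCLM.hasFDerivAt.comp_hasDerivAt _ hg)
  -- At λ = 1/4 the coefficient is real, so the real and imaginary parts of H solve the equation
  -- separately.
  obtain ⟨C₁, hC₁, b₁⟩ := exists_abs_le_of_ode (fun x => dre (hH x).1) (fun x =>
    (dre (hH x).2).congr_deriv (by rw [hcoef, Complex.re_ofReal_mul]))
  obtain ⟨C₂, hC₂, b₂⟩ := exists_abs_le_of_ode (fun x => dim (hH x).1) (fun x =>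
    (dim (hH x).2).congr_deriv (by rw [hcoef, Complex.im_ofReal_mul]))
  refine ⟨(C₁ + C₂) * 8, fun X Y hXY => ?_⟩
  have hY := hXY.2.1
  rw [huberTransform_fPlus hH H0 hY]
  obtain ⟨hX, -, hYU⟩ := hXY
  obtain ⟨u1, u2, u3, u4⟩ := sqrt_bounds hX
  refine norm_mean_le hY fun x hx => ?_
  have hx1 := u1.trans hx.1
  have hx2 : x ≤ 2 * X := by linarith [hx.2]
  have hn : ‖H x‖ ≤ (C₁ + C₂) * (√x * (1 + Real.log x)) := by
    refine (Complex.norm_le_abs_re_add_abs_im _).trans ?_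
    rw [add_mul]
    exact add_le_add (b₁ x hx1) (b₂ x hx1)
  have hlX : Real.log 2 ≤ Real.log X := Real.log_le_log (by norm_num) hX
  have hl2 := Real.log_two_gt_d9
  have hlx : Real.log x ≤ Real.log 2 + Real.log X := by
    rw [← Real.log_mul (by norm_num) (by linarith)]
    exact Real.log_le_log (by linarith) hx2
  have hsx : √x ≤ 2 * X ^ (1 / 2 : ℝ) := by
    rw [← Real.sqrt_eq_rpow, show 2 * √X = √(4 * X) by
      rw [Real.sqrt_mul (by norm_num), show (4 : ℝ) = 2 ^ 2 by norm_num,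
        Real.sqrt_sq (by norm_num)]]
    exact Real.sqrt_le_sqrt (by linarith)
  have hl0 : 0 ≤ Real.log x := Real.log_nonneg hx1
  calc _ ≤ (C₁ + C₂) * (√x * (1 + Real.log x)) := hn
    -- 1 + log x ≤ 1 + log 2 + log X ≤ 4·log X, because X ≥ 2 and 1 + log 2 ≤ 3·log 2.
    _ ≤ (C₁ + C₂) * (2 * X ^ (1 / 2 : ℝ) * (4 * Real.log X)) := by gcongr; linarith
    _ = _ := by ring

end Huber

end

theorem mainTheorem8 :
    -- (a)
    (∃ C : ℝ, ∀ t : ℂ, Huber.SpectralParam t → ∀ X Y : ℝ, Huber.Admissible X Y →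
      ‖Huber.huberTransform (Huber.fPlus X Y) t
          - (Huber.coeffB (1 / 2 + Complex.I * t) * (3 / 2 + Complex.I * t)
                * (X : ℂ) ^ (1 / 2 + Complex.I * t)
              + Huber.coeffD (1 / 2 + Complex.I * t) * (3 / 2 - Complex.I * t)
                * (X : ℂ) ^ (1 / 2 - Complex.I * t))‖
        ≤ C * (‖Huber.coeffB (1 / 2 + Complex.I * t) * (X : ℂ) ^ (-(1 / 2) + Complex.I * t)‖
              + ‖Huber.coeffD (1 / 2 + Complex.I * t) * (X : ℂ) ^ (-(1 / 2) - Complex.I * t)‖)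
            * (1 + ‖t‖ ^ 2) * (Y + X⁻¹)) ∧
    -- (b)
    (∃ (C : ℝ) (α β : ℝ → ℝ → ℂ) (a b : ℝ → ℝ → ℝ → ℂ),
      ∀ t : ℝ, t ≠ 0 → ∀ X Y : ℝ, Huber.Admissible X Y →
        Huber.huberTransform (Huber.fPlus X Y) t
            = a t X Y * (X : ℂ) ^ (1 / 2 + Complex.I * t)
              + b t X Y * (X : ℂ) ^ (1 / 2 - Complex.I * t) ∧
        ‖a t X Y‖ ≤ C * ((t ^ 2)⁻¹ * min |t| (X / Y)) ∧
        ‖b t X Y‖ ≤ C * ((t ^ 2)⁻¹ * min |t| (X / Y)) ∧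
        ‖α t (Y / X)‖ ≤ C * ((t ^ 2)⁻¹ * min |t| (X / Y)) ∧
        ‖β t (Y / X)‖ ≤ C * ((t ^ 2)⁻¹ * min |t| (X / Y)) ∧
        ‖a t X Y - α t (Y / X)‖ ≤ C * ((1 + |t|⁻¹) * (X ^ 2)⁻¹) ∧
        ‖b t X Y - β t (Y / X)‖ ≤ C * ((1 + |t|⁻¹) * (X ^ 2)⁻¹) ∧
        ‖Huber.huberTransform (Huber.fPlus X Y) t‖
          ≤ C * ((t ^ 2)⁻¹ * min |t| (X / Y) * X ^ (1 / 2 : ℝ))) ∧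
    -- (c)
    (∃ C : ℝ, ∀ s : ℝ, 1 / 2 < s → s ≤ 1 → ∀ t : ℂ, (s : ℂ) = 1 / 2 + Complex.I * t →
      ∀ X Y : ℝ, Huber.Admissible X Y →
        ‖Huber.huberTransform (Huber.fPlus X Y) t
            - (Huber.coeffB s * (s + 1) * (X : ℂ) ^ (s : ℂ)
              + Huber.coeffD s * (2 - s) * (X : ℂ) ^ (1 - s : ℂ))‖
          ≤ C * (|Real.Gamma (s - 1 / 2)| * Y + |Real.Gamma (1 / 2 - s)| * X ^ (1 / 2 : ℝ))) ∧
    -- (d)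
    (∃ C : ℝ, ∀ X Y : ℝ, Huber.Admissible X Y →
      ‖Huber.huberTransform (Huber.fPlus X Y) 0‖ ≤ C * (X ^ (1 / 2 : ℝ) * Real.log X)) := by
  refine ⟨⟨96, fun t ht X Y hXY => Huber.norm_huberTransform_sub_le ht hXY⟩, ?_,
    Huber.exists_norm_huberTransform_sub_le_of_real, Huber.exists_norm_huberTransform_zero_le⟩
  -- 2112 = 2·1056 comes from adding the two waves in the final bound; the other estimates need only
  -- 1056.
  refine ⟨2112, fun t => Huber.waveMain (Complex.I * t), fun t => Huber.waveMain (-(Complex.I * t)),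
    fun t => Huber.waveCoeff (Complex.I * t), fun t => Huber.waveCoeff (-(Complex.I * t)),
    fun t ht X Y hXY => ?_⟩
  have hX0 : 0 < X := by linarith [hXY.1]
  have hY := hXY.2.1
  have hYX : Y ≤ X := hXY.2.2.le.trans (Huber.sqrt_bounds hXY.1).2.2.1
  have hμ : Complex.I * (t : ℂ) ≠ 0 := mul_ne_zero Complex.I_ne_zero (by exact_mod_cast ht)
  have hr : (Complex.I * (t : ℂ)).re = 0 := by simp
  have hr' : (-(Complex.I * (t : ℂ))).re = 0 := by simp
  have hn : ‖Complex.I * (t : ℂ)‖ = |t| := by simp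
  have hn' : ‖-(Complex.I * (t : ℂ))‖ = |t| := by simp
  have y0 : 0 < Y / X := by positivity
  have y1 : Y / X ≤ 1 := (div_le_one hX0).2 hYX
  have a1 := Huber.norm_waveCoeff_le hr hμ hXY
  have a2 := Huber.norm_waveCoeff_le hr' (neg_ne_zero.2 hμ) hXY
  have a3 := Huber.norm_waveMain_le hr hμ y0 y1
  have a4 := Huber.norm_waveMain_le hr' (neg_ne_zero.2 hμ) y0 y1
  have a5 := Huber.norm_waveCoeff_sub_le hr hμ hXY
  have a6 := Huber.norm_waveCoeff_sub_le hr' (neg_ne_zero.2 hμ) hXY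
  rw [hn] at a1 a3 a5
  rw [hn'] at a2 a4 a6
  rw [sq_abs] at a1 a2 a3 a4
  rw [one_div_div] at a3 a4
  have m1 : 0 ≤ (t ^ 2)⁻¹ * min |t| (X / Y) := by positivity
  have m2 : 0 ≤ (1 + |t|⁻¹) * (X ^ 2)⁻¹ := by positivity
  exact ⟨Huber.huberTransform_eq_waves ht hXY, by linarith, by linarith, by linarith, by linarith,
    by linarith, by linarith, Huber.norm_huberTransform_le ht hXY⟩
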